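/- **Notation.** An N-function is a continuous even convex $\varphi:\mathbb R\to\mathbb R$ with $\varphi(0)=0$, $\varphi(x)>0$ for $x\ne0$, $\varphi(x)/x\to0$ as $x\to0$, $\varphi(x)/x\to\infty$ as $x\to\infty$. Put $\varphi^*(x)=\sup_{y}(xy-\varphi(y))$, let $\varphi^{(-1)}$ be the inverse of $\varphi$ on $[0,\infty)$, and $\Psi(v)=v/\varphi^{(-1)}(v)$ for $v>0$, $\Psi(0)=0$. Let $\varphi$ be an N-function with $\liminf_{x\to0}\varphi(x)/x^2>0$ (the value $+\infty$ is allowed). $\mathrm{Sub}_\varphi(\Omega)$ is the set of centred random variables $\zeta$ with all exponential moments such that, for some $a>0$, $\mathsf E e^{\lambda\zeta}\le e^{\varphi(a\lambda)}$ for all $\lambda\in\mathbb R$; $\tau_\varphi(\zeta)$ is the infimum of such $a$. A process $y=\{y(v),v\in\mathbb R\}$ with values in $\mathrm{Sub}_\varphi(\Omega)$ is strictly $\varphi$-sub-Gaussian with determining constant $C_y\ge0$ if $\tau_\varphi(\sum_i\lambda_i\zeta_i)\le C_y\big(\mathsf E(\sum_i\lambda_i\zeta_i)^2\big)^{1/2}$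 for all countable, mean-square convergent linear combinations of its values. A function $Z:[0,\infty)\to\mathbb R$ is admissible for $\mathrm{Sub}_\varphi(\Omega)$, with constant $u_0\ge0$, if it is continuous, strictly increasing and unbounded, $Z(v)>0$ for $v>0$, $v/Z(v)$ is non-decreasing for $v>u_0$, and $\int_0^{\varepsilon}\Psi\big(\ln(Z^{(-1)}(1/s)-u_0)\big)\,ds$ converges for some $\varepsilon>0$. **Theorem.** Let $y$ be a real strictly $\varphi$-sub-Gaussian process with determining constant $C_y$ on a probability space, whose covariance $\Gamma_y(t,s)=\mathsf E y(t)y(s)$ has finite variation on $\mathbb R^2$. Let $A>0$, $V=[-A,A]\times[0,\infty)$, $a_1,\dots,a_N\in\mathbb R$, $\kappa=\cos$ or $\kappa=\sin$, and $$U(t,x)=\int_{-\infty}^{\infty}I(t,x,\lambda)\,dy(\lambda),\qquad I(t,x,\lambda)=\kappa\Big(\lambda x+t\sum_{k=1}^N a_k\lambda^{2k+1}(-1)^k\Big),\qquad (x,t)\in V,$$ in the mean-square sense. Assume that $U(t,x)$ exists and is continuous on $V$ with probability one. Let $Z$ be admissible for $\mathrm{Sub}_\varphi(\Omega)$ with constant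 $u_0$, put $G(\lambda)=Z\big(\tfrac{|\lambda|}2+u_0\big)+Z\big(\tfrac12\big|\sum_{k=1}^N a_k\lambda^{2k+1}(-1)^k\big|+u_0\big)$, and let $$C_Z^2=\int_{-\infty}^\infty\int_{-\infty}^\infty G(\lambda)G(\mu)\,d|\Gamma_y(\lambda,\mu)|<\infty,\qquad C_Z\ge0.$$ Assume further: 1. $0=b_0<b_1<b_2<\cdots$, $b_{k+1}-b_k\ge 2A$, and $V_k=[-A,A]\times[b_k,b_{k+1}]$ for $k\ge0$; 2. $c:[0,\infty)\to(0,\infty)$ is continuous, and $c_k=\min_{t\in[b_k,b_{k+1}]}c(t)$; 3. $\varepsilon_k=C_y\sup_{(x,t)\in V_k}\big(\mathsf E|U(t,x)|^2\big)^{1/2}$ satisfies $\sup_{k\ge0}\varepsilon_k/c_k<\infty$; 4. with $$\hat I_{\varphi,k}(\delta)=\int_0^\delta\Psi\Big(\ln\Big[A\Big(Z^{(-1)}\Big(\frac{2C_ZC_y}{s}\Big)-u_0\Big)+1\Big]+\ln\Big[\frac{b_{k+1}-b_k}{2}\Big(Z^{(-1)}\Big(\frac{2C_ZC_y}{s}\Big)-u_0\Big)+1\Big]\Big)\,ds,$$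 one has $\sup_{k\ge0}\hat I_{\varphi,k}(\theta\varepsilon_k)/c_k<\infty$ for some $\theta\in(0,1)$, which is fixed from now on; 5. $u>\sup_{k\ge0}\dfrac{\hat I_{\varphi,k}(\theta\varepsilon_k)}{c_k}\,\dfrac{4}{\theta(1-\theta)}$, and $s$ is such that $\sup_{k\ge0}\dfrac{4\varepsilon_k}{c_k(1-\theta)}<s<\dfrac u2$ and the series $\sum_{k=0}^\infty\exp\big\{-\varphi^*\big(\tfrac{s\,c_k(1-\theta)}{2\varepsilon_k}\big)\big\}$ converges (a term with $\varepsilon_k=0$ is read as $0$). Then $$\mathsf P\Big\{\sup_{(x,t)\in V}\frac{|U(t,x)|}{c(t)}>u\Big\}\le 2\exp\Big\{-\varphi^*\Big(\frac us\Big)\Big\}\sum_{k=0}^\infty\exp\Big\{-\varphi^*\Big(\frac{s\,c_k(1-\theta)}{2\varepsilon_k}\Big)\Big\}.$$ -/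

import Mathlib

open MeasureTheory Filter Topology Set
open scoped ENNReal NNReal BigOperators

noncomputable section

namespace HeatSup

/-! ### Orlicz N-functions -/

/-- Orlicz N-function. -/
structure IsNFunction (φ : ℝ → ℝ) : Prop where
  continuous : Continuous φ
  even : ∀ x, φ (-x) = φ x
  convex : ConvexOn ℝ univ φ
  map_zero : φ 0 = 0
  pos : ∀ x, x ≠ 0 → 0 < φ x
  tendsto_zero : Tendsto (fun x => φ x / x) (𝓝[≠] 0) (𝓝 0)
  tendsto_top : Tendsto (fun x => φ x / x) atTop atTop

/-- Condition Q: `liminf_{x → 0} φ(x) / x² > 0`, the value `+∞` being allowed. -/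
def ConditionQ (φ : ℝ → ℝ) : Prop :=
  0 < liminf (fun x : ℝ => ((φ x / x ^ 2 : ℝ) : EReal)) (𝓝[≠] 0)

/-- Young–Fenchel transform `φ*(x) = sup_y (x y - φ(y))`. -/
def conj (φ : ℝ → ℝ) (x : ℝ) : ℝ := ⨆ y : ℝ, (x * y - φ y)

/-- Inverse `f⁽⁻¹⁾` of a continuous strictly increasing function `f` on `[0, ∞)`: for `v` in the
range of `f` on `[0, ∞)` this is the unique `x ≥ 0` with `f x = v`. -/
def inv (f : ℝ → ℝ) (v : ℝ) : ℝ := sInf {x : ℝ | 0 ≤ x ∧ v ≤ f x}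

/-- `Ψ(v) = v / φ⁽⁻¹⁾(v)` for `v > 0`, and `Ψ(0) = 0` (its limit). -/
def Psi (φ : ℝ → ℝ) (v : ℝ) : ℝ := v / inv φ v

/-! ### φ-sub-Gaussian variables and processes -/

variable {Ω : Type*} [MeasurableSpace Ω]

/-- The space `Sub_φ(Ω)`. -/
structure IsPhiSub (P : Measure Ω) (φ : ℝ → ℝ) (ζ : Ω → ℝ) : Prop where
  aemeasurable : AEMeasurable ζ P
  mean_zero : ∫ ω, ζ ω ∂P = 0
  integrable_exp : ∀ l : ℝ, Integrable (fun ω => Real.exp (l * ζ ω)) P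
  bound : ∃ a : ℝ, 0 < a ∧ ∀ l : ℝ, ∫ ω, Real.exp (l * ζ ω) ∂P ≤ Real.exp (φ (l * a))

/-- The standard `τ_φ(ζ) = inf {a > 0 : E exp(l ζ) ≤ exp(φ(a l)) for all l}`, equal to `∞` if there
is no such `a`. -/
def tau (P : Measure Ω) (φ : ℝ → ℝ) (ζ : Ω → ℝ) : ℝ≥0∞ :=
  ⨅ (a : ℝ) (_ : 0 < a ∧ ∀ l : ℝ,
      ∫⁻ ω, ENNReal.ofReal (Real.exp (l * ζ ω)) ∂P ≤ ENNReal.ofReal (Real.exp (φ (a * l)))),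
    ENNReal.ofReal a

/-- A family `Δ ⊆ Sub_φ(Ω)` is strictly φ-sub-Gaussian with determining constant `C`: for all
countable linear combinations (convergent in mean square) of elements of `Δ`,
`τ_φ(∑ l_i ζ_i) ≤ C (E (∑ l_i ζ_i)²)^{1/2}`. Finite combinations are those with `l i = 0` for all
large `i`. -/
structure IsStrictlyPhiSubFamily (P : Measure Ω) (φ : ℝ → ℝ) (Δ : Set (Ω → ℝ)) (C : ℝ) :
    Prop where
  nonneg : 0 ≤ C
  mem : ∀ ζ ∈ Δ, IsPhiSub P φ ζ
  tau_le : ∀ (ζ : ℕ → Ω → ℝ) (l : ℕ → ℝ) (S : Ω → ℝ), (∀ i, ζ i ∈ Δ) → MemLp S 2 P →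
    Tendsto (fun n => eLpNorm (fun ω => ∑ i ∈ Finset.range n, l i * ζ i ω - S ω) 2 P)
      atTop (𝓝 0) →
    tau P φ S ≤ ENNReal.ofReal C * eLpNorm S 2 P

/-- A strictly φ-sub-Gaussian process with determining constant `C`. -/
def IsStrictlyPhiSubProcess (P : Measure Ω) (φ : ℝ → ℝ) (y : ℝ → Ω → ℝ) (C : ℝ) : Prop :=
  IsStrictlyPhiSubFamily P φ (range y) C

/-- `Z` (with the constant `u₀`) is an admissible function for `Sub_φ(Ω)`. Unboundedness of `Z` is
what makes `Z⁽⁻¹⁾(1/s)` meaningful for small `s`. -/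
structure IsAdmissible (φ Z : ℝ → ℝ) (u₀ : ℝ) : Prop where
  nonneg : 0 ≤ u₀
  continuousOn : ContinuousOn Z (Ici 0)
  strictMonoOn : StrictMonoOn Z (Ici 0)
  pos : ∀ u, 0 < u → 0 < Z u
  monotoneOn_div : MonotoneOn (fun u => u / Z u) (Ioi u₀)
  tendsto_top : Tendsto Z atTop atTop
  integrable : ∃ ε : ℝ, 0 < ε ∧
    IntegrableOn (fun s => Psi φ (Real.log (inv Z (1 / s) - u₀))) (Ioo 0 ε)

/-! ### Covariances of finite variation and integrals with respect to them -/

/-- Covariance function `E y(t) y(s)` of a centred process. -/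
def covFun (P : Measure Ω) (y : ℝ → Ω → ℝ) (t s : ℝ) : ℝ := ∫ ω, y t ω * y s ω ∂P

/-- Increment of `g` over the rectangle `[a, b] × [c, d]`. -/
def rectInc (g : ℝ → ℝ → ℝ) (a b c d : ℝ) : ℝ := g b d - g a d - g b c + g a c

/-- Variation of `g` over the plane: the supremum of `∑ᵢ ∑ⱼ |Δᵢ Δⱼ g|` over all finite grids
`p 0 ≤ … ≤ p n`, `q 0 ≤ … ≤ q m`. -/
def planeVariation (g : ℝ → ℝ → ℝ) : ℝ≥0∞ :=
  ⨆ (p : ℕ × {p : ℕ → ℝ // Monotone p}) (q : ℕ × {q : ℕ → ℝ // Monotone q}),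
    ∑ i ∈ Finset.range p.1, ∑ j ∈ Finset.range q.1,
      ENNReal.ofReal |rectInc g (p.2.1 i) (p.2.1 (i + 1)) (q.2.1 j) (q.2.1 (j + 1))|

/-- The integral `∬ f d|g|` of a continuous `f ≥ 0` over the plane, as the limit of the sums
`∑ᵢ ∑ⱼ f |Δᵢ Δⱼ g|` along refining and expanding finite grids. The sums are taken with the infimum
of `f` on each cell; they then increase under refinement, so that the limit is the supremum. -/
def absIntegral (g : ℝ → ℝ → ℝ) (f : ℝ → ℝ → ℝ≥0∞) : ℝ≥0∞ :=
  ⨆ (p : ℕ × {p : ℕ → ℝ // Monotone p}) (q : ℕ × {q : ℕ → ℝ // Monotone q}),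
    ∑ i ∈ Finset.range p.1, ∑ j ∈ Finset.range q.1,
      (⨅ (l ∈ Icc (p.2.1 i) (p.2.1 (i + 1))) (m ∈ Icc (q.2.1 j) (q.2.1 (j + 1))), f l m) *
      ENNReal.ofReal |rectInc g (p.2.1 i) (p.2.1 (i + 1)) (q.2.1 j) (q.2.1 (j + 1))|

/-! ### Mean-square integrals -/

/-- `J = ∫_a^b f dy` in the mean-square sense: the Riemann–Stieltjes sums converge to `J` in
`L²(P)` as the mesh of the partition tends to zero, for every choice of the tags. -/
def HasMSIntegralOn (P : Measure Ω) (y : ℝ → Ω → ℝ) (f : ℝ → ℝ) (a b : ℝ) (J : Ω → ℝ) : Prop :=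
  MemLp J 2 P ∧ ∀ ε : ℝ≥0∞, 0 < ε → ∃ δ : ℝ, 0 < δ ∧
    ∀ (n : ℕ) (p ξ : ℕ → ℝ), Monotone p → p 0 = a → p n = b →
      (∀ i < n, p (i + 1) - p i < δ) → (∀ i < n, ξ i ∈ Icc (p i) (p (i + 1))) →
      eLpNorm (fun ω => ∑ i ∈ Finset.range n, f (ξ i) * (y (p (i + 1)) ω - y (p i) ω) - J ω) 2 P
        ≤ ε

/-- `J = ∫_{-∞}^{∞} f dy` in the mean-square sense: the `L²(P)`-limit of `∫_a^b f dy` as `a → -∞`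
and `b → ∞`. -/
def HasMSIntegral (P : Measure Ω) (y : ℝ → Ω → ℝ) (f : ℝ → ℝ) (J : Ω → ℝ) : Prop :=
  MemLp J 2 P ∧ ∃ K : ℝ → ℝ → Ω → ℝ, (∀ a b, a ≤ b → HasMSIntegralOn P y f a b (K a b)) ∧
    Tendsto (fun q : ℝ × ℝ => eLpNorm (fun ω => K q.1 q.2 ω - J ω) 2 P) (atBot ×ˢ atTop) (𝓝 0)

/-! ### The field and the quantities attached to it -/

/-- `∑_{k=1}^N a_k l^{2k+1} (-1)^k`. -/
def symb (N : ℕ) (a : ℕ → ℝ) (l : ℝ) : ℝ :=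
  ∑ k ∈ Finset.Icc 1 N, a k * l ^ (2 * k + 1) * (-1) ^ k

/-- The kernel `I(t, x, l) = κ(l x + t ∑_{k=1}^N a_k l^{2k+1} (-1)^k)`. -/
def kernelI (κ : ℝ → ℝ) (N : ℕ) (a : ℕ → ℝ) (t x l : ℝ) : ℝ := κ (l * x + t * symb N a l)

/-- `Z(|l|/2 + u₀) + Z(|∑ a_k l^{2k+1} (-1)^k|/2 + u₀)`. -/
def zWeight (Z : ℝ → ℝ) (u₀ : ℝ) (N : ℕ) (a : ℕ → ℝ) (l : ℝ) : ℝ :=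
  Z (|l| / 2 + u₀) + Z (1 / 2 * |symb N a l| + u₀)

/-- The square of the constant `C_Z`, with values in `[0, ∞]`. -/
def CZsq (P : Measure Ω) (y : ℝ → Ω → ℝ) (Z : ℝ → ℝ) (u₀ : ℝ) (N : ℕ) (a : ℕ → ℝ) : ℝ≥0∞ :=
  absIntegral (covFun P y)
    (fun l m => ENNReal.ofReal (zWeight Z u₀ N a l * zWeight Z u₀ N a m))

/-- The constant `C_Z`. -/
def CZ (P : Measure Ω) (y : ℝ → Ω → ℝ) (Z : ℝ → ℝ) (u₀ : ℝ) (N : ℕ) (a : ℕ → ℝ) : ℝ :=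
  Real.sqrt (CZsq P y Z u₀ N a).toReal

/-- `c_k`, the minimum of `c` over `[b_k, b_{k+1}]`. -/
def blockMin (c : ℝ → ℝ) (b : ℕ → ℝ) (k : ℕ) : ℝ := sInf (c '' Icc (b k) (b (k + 1)))

/-- `ε_k = C_y sup_{V_k} (E |U(t, x)|²)^{1/2}`, `V_k = [-A, A] × [b_k, b_{k+1}]`. -/
def blockEps (P : Measure Ω) (U : ℝ → ℝ → Ω → ℝ) (Cy A : ℝ) (b : ℕ → ℝ) (k : ℕ) : ℝ :=
  Cy * sSup ((fun q : ℝ × ℝ => Real.sqrt (∫ ω, |U q.2 q.1 ω| ^ 2 ∂P)) ''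
    (Icc (-A) A ×ˢ Icc (b k) (b (k + 1))))

/-- The entropy integral `Î_{φ,k}(δ)`; here `L = b_{k+1} - b_k` and `K = 2 C_Z C_y`. -/
def entropyInt (φ Z : ℝ → ℝ) (u₀ A L K δ : ℝ) : ℝ :=
  ∫ s in (0 : ℝ)..δ, Psi φ (Real.log (A * (inv Z (K / s) - u₀) + 1) +
    Real.log (L / 2 * (inv Z (K / s) - u₀) + 1))

/-- `exp(-φ*(s c_k (1-θ) / (2 ε_k)))`, read as `exp(-∞) = 0` when `ε_k = 0`. -/
def blockTerm (φ : ℝ → ℝ) (θ s ck εk : ℝ) : ℝ :=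
  if εk = 0 then 0 else Real.exp (-conj φ (s * ck * (1 - θ) / (2 * εk)))

end HeatSup

end

/-!
The field is bounded on each block `V_k` by chaining, and the blocks are added up.

Mean-square integrals are `L²`-limits of finite combinations of values of `y`, so they inherit the
bound `E exp(l ζ) ≤ exp(φ(l C_y ‖ζ‖₂))` (`HasMSIntegral.subExp`). The tags of the approximating
Riemann–Stieltjes sums may be chosen freely; with tags that minimize `G = zWeight Z u₀ N a` on their
cells, the second moments of the sums are dominated by the lower sums that define `C_Z`, whence
`‖∫ f dy‖₂ ≤ ρ C_Z` as soon as `|f| ≤ ρ G` (`HasMSIntegral.eLpNorm_le`). Admissibility gives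
`min(1, h v) ≤ Z(v + u₀) / Z(1/h + u₀)`, so two points of the half-strip whose coordinates differ
by at most `h` have mean-square distance at most `2 C_Z / Z(1/h + u₀)`
(`eLpNorm_sub_le_of_abs_le`). A grid of mesh `1 / (Z⁽⁻¹⁾(2 C_Z C_y / s) - u₀)` in `V_k` is
therefore a net of mesh `s` for the distance `C_y ‖·‖₂`, and the logarithm of its size is at most
the argument of `Ψ` in the entropy integral (`exists_nets`).

Chaining along the nets of mesh `ε_k θ^j`, with Hölder exponents that depend on the level and
balance the exponential moments of the links against the size of the net
(`measure_exists_lt_abs_le`), bounds the tail of the supremum over `V_k` by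
`2 exp(φ(l ε_k / (1 - θ)) + 2 l B - l w)` for every `l > 0`, where
`B = Î_{φ,k}(θ ε_k) / (θ (1 - θ))`. Optimization over `l` produces `φ*`
(`measure_exists_lt_abs_le_of_nets`). For `w = u c_k` the assumption on `u` gives `2 B ≤ w / 2`, so
the exponent is at least `φ*((u / s) (s c_k (1 - θ) / (2 ε_k)))`. Both factors are at least `2`, and
`φ*(x y) ≥ φ*(x) + φ*(y)` for `x, y ≥ 2` splits off the factor `exp(-φ*(u / s))`.
-/

namespace HeatSup

/-! ### Generalized inverses, N-functions and their conjugates -/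

section Inverse

variable {f : ℝ → ℝ}

lemma inv_nonneg (f : ℝ → ℝ) (v : ℝ) : 0 ≤ inv f v :=
  Real.sInf_nonneg fun _ hx => hx.1

lemma exists_preimage (hc : ContinuousOn f (Ici 0)) (ht : Tendsto f atTop atTop) {v : ℝ}
    (hv : f 0 ≤ v) : ∃ x, 0 ≤ x ∧ f x = v := by
  obtain ⟨M, hM0, hM⟩ := ((eventually_ge_atTop 0).and (ht.eventually_ge_atTop v)).exists
  obtain ⟨x, hx, rfl⟩ := intermediate_value_Icc hM0 (hc.mono Icc_subset_Ici_self) ⟨hv, hM⟩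
  exact ⟨x, hx.1, rfl⟩

lemma inv_apply (hm : StrictMonoOn f (Ici 0)) {x : ℝ} (hx : 0 ≤ x) : inv f (f x) = x := by
  have : {z : ℝ | 0 ≤ z ∧ f x ≤ f z} = Ici x := by
    ext z
    constructor
    · rintro ⟨hz, h⟩
      exact (hm.le_iff_le hx hz).1 h
    · intro h
      exact ⟨hx.trans h, (hm.le_iff_le hx (hx.trans h)).2 h⟩
  rw [inv, this, csInf_Ici]

lemma apply_inv (hc : ContinuousOn f (Ici 0)) (hm : StrictMonoOn f (Ici 0))
    (ht : Tendsto f atTop atTop) {v : ℝ} (hv : f 0 ≤ v) : f (inv f v) = v := by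
  obtain ⟨x, hx, rfl⟩ := exists_preimage hc ht hv
  rw [inv_apply hm hx]

lemma inv_mono (ht : Tendsto f atTop atTop) {v w : ℝ} (h : v ≤ w) : inv f v ≤ inv f w := by
  apply csInf_le_csInf
  · exact ⟨0, fun _ hx => hx.1⟩
  · obtain ⟨M, hM0, hM⟩ := ((eventually_ge_atTop 0).and (ht.eventually_ge_atTop w)).exists
    exact ⟨M, hM0, hM⟩
  · exact fun x hx => ⟨hx.1, h.trans hx.2⟩

lemma lt_inv_of_lt (hc : ContinuousOn f (Ici 0)) (hm : StrictMonoOn f (Ici 0))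
    (ht : Tendsto f atTop atTop) {x v : ℝ} (hx : 0 ≤ x) (h : f x < v) : x < inv f v := by
  have h0 : f 0 ≤ v := (hm.monotoneOn (mem_Ici.2 le_rfl) hx hx).trans h.le
  rw [← apply_inv hc hm ht h0] at h
  exact (hm.lt_iff_lt hx (inv_nonneg f v)).1 h

end Inverse

namespace IsNFunction

variable {φ : ℝ → ℝ} (hφ : IsNFunction φ)
include hφ

lemma nonneg (x : ℝ) : 0 ≤ φ x := by
  rcases eq_or_ne x 0 with rfl | h
  · exact hφ.map_zero.ge
  · exact (hφ.pos x h).le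

/-- Convexity and `φ 0 = 0`. -/
lemma map_mul_le {c x : ℝ} (hc0 : 0 ≤ c) (hc1 : c ≤ 1) : φ (c * x) ≤ c * φ x := by
  have := hφ.convex.2 (mem_univ x) (mem_univ 0) hc0 (sub_nonneg.2 hc1) (by ring)
  simpa [hφ.map_zero] using this

lemma strictMonoOn : StrictMonoOn φ (Ici 0) := by
  intro x hx y hy hxy
  have hy0 : 0 < y := lt_of_le_of_lt hx hxy
  have h1 := hφ.map_mul_le (x := y) (div_nonneg hx hy0.le) ((div_le_one hy0).2 hxy.le)
  rw [div_mul_cancel₀ _ hy0.ne'] at h1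
  have : x / y * φ y < 1 * φ y :=
    mul_lt_mul_of_pos_right ((div_lt_one hy0).2 hxy) (hφ.pos y hy0.ne')
  linarith

lemma map_abs (x : ℝ) : φ |x| = φ x := by
  rcases abs_choice x with h | h <;> rw [h]
  exact hφ.even x

lemma mono_abs {x y : ℝ} (h : |x| ≤ |y|) : φ x ≤ φ y := by
  rw [← hφ.map_abs x, ← hφ.map_abs y]
  exact hφ.strictMonoOn.monotoneOn (abs_nonneg x) (abs_nonneg y) h

lemma tendsto_atTop : Tendsto φ atTop atTop := by
  have := hφ.tendsto_top.atTop_mul_atTop₀ tendsto_id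
  refine this.congr' ?_
  filter_upwards [eventually_ne_atTop 0] with x hx
  simp [hx]

lemma apply_inv {v : ℝ} (hv : 0 ≤ v) : φ (inv φ v) = v :=
  HeatSup.apply_inv hφ.continuous.continuousOn hφ.strictMonoOn hφ.tendsto_atTop
    (hφ.map_zero.trans_le hv)

lemma inv_pos {v : ℝ} (hv : 0 < v) : 0 < inv φ v :=
  lt_inv_of_lt hφ.continuous.continuousOn hφ.strictMonoOn hφ.tendsto_atTop le_rfl
    (by rwa [hφ.map_zero])

lemma inv_mono {v w : ℝ} (h : v ≤ w) : inv φ v ≤ inv φ w :=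
  HeatSup.inv_mono hφ.tendsto_atTop h

omit hφ in
lemma Psi_nonneg {v : ℝ} (hv : 0 ≤ v) : 0 ≤ Psi φ v :=
  div_nonneg hv (inv_nonneg φ v)

/-- `φ(x)/x` is non-decreasing by convexity, and `Ψ(φ(x)) = φ(x)/x`. -/
lemma Psi_monotoneOn : MonotoneOn (Psi φ) (Ici 0) := by
  intro v hv w hw hvw
  rcases eq_or_lt_of_le (mem_Ici.1 hv) with rfl | hv0
  · simpa [Psi] using Psi_nonneg (φ := φ) hw
  have hw0 : 0 < w := hv0.trans_le hvw
  have ha := hφ.inv_pos hv0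
  have hb := hφ.inv_pos hw0
  have h1 := hφ.map_mul_le (x := inv φ w) (div_nonneg ha.le hb.le)
    ((div_le_one hb).2 (hφ.inv_mono hvw))
  rw [div_mul_cancel₀ _ hb.ne', hφ.apply_inv hv, hφ.apply_inv hw] at h1
  rw [Psi, Psi, div_le_div_iff₀ ha hb]
  rw [div_mul_eq_mul_div, le_div_iff₀ hb] at h1
  linarith

lemma Psi_mul_le {C v : ℝ} (hC : 1 ≤ C) (hv : 0 ≤ v) : Psi φ (C * v) ≤ C * Psi φ v := by
  rcases eq_or_lt_of_le hv with rfl | hv0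
  · simp [Psi]
  rw [Psi, Psi, ← mul_div_assoc]
  have : v ≤ C * v := by nlinarith
  exact div_le_div_of_nonneg_left (by positivity) (hφ.inv_pos hv0) (hφ.inv_mono this)

lemma bddAbove_conj (x : ℝ) : BddAbove (range fun y : ℝ => x * y - φ y) := by
  obtain ⟨M, hM0, hM⟩ :=
    ((eventually_ge_atTop 1).and (hφ.tendsto_top.eventually_ge_atTop |x|)).exists
  refine ⟨|x| * M, ?_⟩
  rintro _ ⟨y, rfl⟩
  have h1 : x * y ≤ |x| * |y| := by rw [← abs_mul]; exact le_abs_self _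
  have hM' : |x| * M ≤ φ M := by rwa [le_div_iff₀ (by linarith)] at hM
  change x * y - φ y ≤ |x| * M
  rcases le_total |y| M with h | h
  · nlinarith [hφ.nonneg y, abs_nonneg x]
  · -- beyond `M` the quotient `φ(y)/y` exceeds `|x|`
    have hy : 0 < |y| := by linarith
    have h2 := hφ.map_mul_le (x := |y|) (div_nonneg (by linarith : (0:ℝ) ≤ M) hy.le)
      ((div_le_one hy).2 h)
    rw [div_mul_cancel₀ _ hy.ne', hφ.map_abs, div_mul_eq_mul_div, le_div_iff₀ hy] at h2
    have h3 : |x| * |y| ≤ φ y := by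
      have : M * (|x| * |y|) ≤ M * φ y := by nlinarith
      exact le_of_mul_le_mul_left this (by linarith)
    have : 0 ≤ |x| * M := mul_nonneg (abs_nonneg x) (by linarith)
    linarith

lemma le_conj (x y : ℝ) : x * y - φ y ≤ conj φ x :=
  le_ciSup (hφ.bddAbove_conj x) y

lemma conj_nonneg (x : ℝ) : 0 ≤ conj φ x := by
  simpa [hφ.map_zero] using hφ.le_conj x 0

lemma conj_mul_le {c x : ℝ} (hc0 : 0 ≤ c) (hc1 : c ≤ 1) : conj φ (c * x) ≤ c * conj φ x := by
  refine ciSup_le fun y => ?_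
  have := mul_le_mul_of_nonneg_left (hφ.le_conj x y) hc0
  nlinarith [hφ.nonneg y]

lemma conj_mono {x x' : ℝ} (h0 : 0 ≤ x) (h : x ≤ x') : conj φ x ≤ conj φ x' := by
  rcases eq_or_lt_of_le (h0.trans h) with h' | h'
  · rw [le_antisymm (h.trans h'.symm.le) h0, ← h']
  have h1 := hφ.conj_mul_le (x := x') (div_nonneg h0 h'.le) ((div_le_one h').2 h)
  rw [div_mul_cancel₀ _ h'.ne'] at h1
  have : x / x' ≤ 1 := (div_le_one h').2 h
  nlinarith [hφ.conj_nonneg x']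

/-- `φ*` is convex with `φ*(0) = 0`, hence superadditive on `[0, ∞)`, and `x + y ≤ x y`. -/
lemma conj_add_le_conj_mul {x y : ℝ} (hx : 2 ≤ x) (hy : 2 ≤ y) :
    conj φ x + conj φ y ≤ conj φ (x * y) := by
  have hx0 : x ≠ 0 := by linarith
  have hy0 : y ≠ 0 := by linarith
  have hx' : x⁻¹ ≤ 2⁻¹ := inv_anti₀ (by norm_num) hx
  have hy' : y⁻¹ ≤ 2⁻¹ := inv_anti₀ (by norm_num) hy
  have h1 := hφ.conj_mul_le (c := y⁻¹) (x := x * y) (by positivity) (by linarith)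
  have h2 := hφ.conj_mul_le (c := x⁻¹) (x := x * y) (by positivity) (by linarith)
  rw [show y⁻¹ * (x * y) = x by field_simp] at h1
  rw [show x⁻¹ * (x * y) = y by field_simp] at h2
  nlinarith [hφ.conj_nonneg (x * y)]

end IsNFunction

/-! ### Exponential bounds and their stability under mean-square limits -/

section SubExp

variable {Ω : Type*} [MeasurableSpace Ω] {P : Measure Ω} {φ : ℝ → ℝ}

/-- `E exp(l ζ) ≤ exp(φ(a l))` for all real `l`. The expectation is a lower integral, so that the
bound contains the existence of the exponential moments. -/
def SubExp (P : Measure Ω) (φ : ℝ → ℝ) (ζ : Ω → ℝ) (a : ℝ) : Prop :=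
  ∀ l : ℝ, ∫⁻ ω, ENNReal.ofReal (Real.exp (l * ζ ω)) ∂P ≤ ENNReal.ofReal (Real.exp (φ (a * l)))

lemma SubExp.mono (hφ : IsNFunction φ) {ζ : Ω → ℝ} {a a' : ℝ} (h : SubExp P φ ζ a)
    (ha : 0 ≤ a) (haa' : a ≤ a') : SubExp P φ ζ a' := by
  refine fun l => (h l).trans (ENNReal.ofReal_le_ofReal (Real.exp_le_exp.2 (hφ.mono_abs ?_)))
  rw [abs_mul, abs_mul, abs_of_nonneg ha, abs_of_nonneg (ha.trans haa')]
  gcongr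

/-- A limit of exponential bounds under mean-square convergence, by Fatou's lemma along a
subsequence that converges almost surely. -/
lemma SubExp.of_tendsto (hφ : IsNFunction φ) {S : ℕ → Ω → ℝ} {T : Ω → ℝ} {a : ℕ → ℝ} {a' : ℝ}
    (hS : ∀ n, AEStronglyMeasurable (S n) P) (hT : AEStronglyMeasurable T P)
    (hST : Tendsto (fun n => eLpNorm (S n - T) 2 P) atTop (𝓝 0))
    (ha : Tendsto a atTop (𝓝 a')) (h : ∀ n, SubExp P φ (S n) (a n)) : SubExp P φ T a' := by
  obtain ⟨ns, hns, hae⟩ :=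
    (tendstoInMeasure_of_tendsto_eLpNorm two_ne_zero hS hT hST).exists_seq_tendsto_ae
  intro l
  have hlim : Tendsto (fun n => ENNReal.ofReal (Real.exp (φ (a (ns n) * l)))) atTop
      (𝓝 (ENNReal.ofReal (Real.exp (φ (a' * l))))) :=
    ENNReal.tendsto_ofReal ((Real.continuous_exp.tendsto _).comp ((hφ.continuous.tendsto _).comp
      ((ha.comp hns.tendsto_atTop).mul_const l)))
  calc ∫⁻ ω, ENNReal.ofReal (Real.exp (l * T ω)) ∂P
      = ∫⁻ ω, liminf (fun n => ENNReal.ofReal (Real.exp (l * S (ns n) ω))) atTop ∂P := by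
        refine lintegral_congr_ae ?_
        filter_upwards [hae] with ω hω
        exact (Tendsto.liminf_eq (ENNReal.tendsto_ofReal
          ((Real.continuous_exp.tendsto _).comp (hω.const_mul l)))).symm
    _ ≤ liminf (fun n => ∫⁻ ω, ENNReal.ofReal (Real.exp (l * S (ns n) ω)) ∂P) atTop :=
        lintegral_liminf_le' fun n =>
          (Real.measurable_exp.comp_aemeasurable
            ((hS (ns n)).aemeasurable.const_mul l)).ennreal_ofReal
    _ ≤ liminf (fun n => ENNReal.ofReal (Real.exp (φ (a (ns n) * l)))) atTop :=
        liminf_le_liminf (Eventually.of_forall fun n => h (ns n) l)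
    _ = _ := hlim.liminf_eq

/-- The infimum that defines `τ_φ` is attained, by continuity of `φ`. -/
lemma subExp_of_tau_le (hφ : IsNFunction φ) {ζ : Ω → ℝ} {a : ℝ} (ha : 0 ≤ a)
    (h : tau P φ ζ ≤ ENNReal.ofReal a) : SubExp P φ ζ a := by
  have key : ∀ a' > a, SubExp P φ ζ a' := by
    intro a' ha'
    have hlt : tau P φ ζ < ENNReal.ofReal a' :=
      h.trans_lt ((ENNReal.ofReal_lt_ofReal_iff (ha.trans_lt ha')).2 ha')
    rw [tau] at hlt
    simp only [iInf_lt_iff] at hlt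
    obtain ⟨b, ⟨hb0, hb⟩, hba⟩ := hlt
    exact SubExp.mono hφ hb hb0.le ((ENNReal.ofReal_lt_ofReal_iff (ha.trans_lt ha')).1 hba).le
  intro l
  have hlim : Tendsto (fun a' => ENNReal.ofReal (Real.exp (φ (a' * l)))) (𝓝[>] a)
      (𝓝 (ENNReal.ofReal (Real.exp (φ (a * l))))) := by
    refine ENNReal.tendsto_ofReal (Tendsto.mono_left ?_ nhdsWithin_le_nhds)
    exact (Real.continuous_exp.comp (hφ.continuous.comp (continuous_mul_const l))).tendsto a
  refine ge_of_tendsto hlim ?_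
  filter_upwards [self_mem_nhdsWithin] with a' ha'
  exact key a' ha' l

lemma IsPhiSub.memLp_two {ζ : Ω → ℝ} (h : IsPhiSub P φ ζ) : MemLp ζ 2 P := by
  have : ProbabilityTheory.integrableExpSet ζ P = univ := eq_univ_of_forall h.integrable_exp
  simpa using ProbabilityTheory.memLp_of_mem_interior_integrableExpSet (X := ζ) (μ := P)
    (by simp [this]) 2

/-- Finite linear combinations are countable ones with vanishing coefficients from some index on. -/
lemma IsStrictlyPhiSubFamily.subExp_sum (hφ : IsNFunction φ) {Δ : Set (Ω → ℝ)} {C : ℝ}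
    (hΔ : IsStrictlyPhiSubFamily P φ Δ C) (n : ℕ) (ζ : ℕ → Ω → ℝ) (l : ℕ → ℝ)
    (hζ : ∀ i, ζ i ∈ Δ) :
    SubExp P φ (fun ω => ∑ i ∈ Finset.range n, l i * ζ i ω)
      (C * (eLpNorm (fun ω => ∑ i ∈ Finset.range n, l i * ζ i ω) 2 P).toReal) := by
  have hS : MemLp (fun ω => ∑ i ∈ Finset.range n, l i * ζ i ω) 2 P :=
    memLp_finsetSum _ fun i _ => ((hΔ.mem _ (hζ i)).memLp_two).const_mul (l i)
  have h := hΔ.tau_le ζ (fun i => if i < n then l i else 0) _ hζ hS (by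
    refine tendsto_const_nhds.congr' ?_
    filter_upwards [eventually_ge_atTop n] with m hm
    rw [← eLpNorm_zero' (ε := ℝ) (p := 2) (μ := P)]
    congr 1
    funext ω
    rw [← Finset.sum_range_add_sum_Ico _ hm,
      Finset.sum_congr rfl fun i hi => by rw [if_pos (Finset.mem_range.1 hi)],
      Finset.sum_eq_zero (s := Finset.Ico n m) fun i hi => by
        rw [if_neg (not_lt.2 (Finset.mem_Ico.1 hi).1), zero_mul]]
    ring)
  refine subExp_of_tau_le hφ (mul_nonneg hΔ.nonneg ENNReal.toReal_nonneg) ?_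
  rwa [ENNReal.ofReal_mul hΔ.nonneg, ENNReal.ofReal_toReal hS.eLpNorm_ne_top]

end SubExp

/-! ### Mean-square Riemann–Stieltjes integrals -/

section MeanSquare

variable {Ω : Type*} [MeasurableSpace Ω] {P : Measure Ω} {φ : ℝ → ℝ} {y : ℝ → Ω → ℝ}

/-- The Riemann–Stieltjes sum of `f` with respect to `y`, with nodes `p` and tags `ξ`. -/
def riemannSum (y : ℝ → Ω → ℝ) (f : ℝ → ℝ) (n : ℕ) (p ξ : ℕ → ℝ) (ω : Ω) : ℝ :=
  ∑ i ∈ Finset.range n, f (ξ i) * (y (p (i + 1)) ω - y (p i) ω)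

lemma memLp_riemannSum (hy : ∀ t, MemLp (y t) 2 P) (f : ℝ → ℝ) (n : ℕ) (p ξ : ℕ → ℝ) :
    MemLp (riemannSum y f n p ξ) 2 P :=
  memLp_finsetSum _ fun i _ => ((hy (p (i + 1))).sub (hy (p i))).const_mul (f (ξ i))

omit [MeasurableSpace Ω] in
lemma riemannSum_eq_sum_range (f : ℝ → ℝ) (n : ℕ) (p ξ : ℕ → ℝ) :
    riemannSum y f n p ξ = fun ω => ∑ j ∈ Finset.range (2 * n),
      (if j % 2 = 0 then -f (ξ (j / 2)) else f (ξ (j / 2))) * y (p ((j + 1) / 2)) ω := by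
  funext ω
  induction n with
  | zero => simp [riemannSum]
  | succ n ih =>
    rw [riemannSum, Finset.sum_range_succ, show 2 * (n + 1) = 2 * n + 1 + 1 by ring,
      Finset.sum_range_succ, Finset.sum_range_succ, ← ih, riemannSum,
      show (2 * n) % 2 = 0 by omega, show (2 * n + 1) % 2 = 1 by omega,
      show 2 * n / 2 = n by omega, show (2 * n + 1) / 2 = n by omega,
      show (2 * n + 1 + 1) / 2 = n + 1 by omega]
    simp
    ring

lemma eLpNorm_two_eq_sqrt {S : Ω → ℝ} (hS : MemLp S 2 P) :
    eLpNorm S 2 P = ENNReal.ofReal (Real.sqrt (∫ ω, S ω ^ 2 ∂P)) := by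
  rw [hS.eLpNorm_eq_integral_rpow_norm two_ne_zero ENNReal.ofNat_ne_top, Real.sqrt_eq_rpow]
  simp

lemma rectInc_covFun (hy : ∀ t, MemLp (y t) 2 P) (a b c d : ℝ) :
    rectInc (covFun P y) a b c d = ∫ ω, (y b ω - y a ω) * (y d ω - y c ω) ∂P := by
  have h : ∀ s t, Integrable (fun ω => y s ω * y t ω) P := fun s t =>
    (hy s).integrable_mul (hy t)
  have : ∀ ω, (y b ω - y a ω) * (y d ω - y c ω) =
      y b ω * y d ω - y a ω * y d ω - y b ω * y c ω + y a ω * y c ω := fun ω => by ring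
  simp_rw [this]
  have h1 : Integrable (fun ω => y b ω * y d ω - y a ω * y d ω) P := (h b d).sub (h a d)
  have h2 : Integrable (fun ω => y b ω * y d ω - y a ω * y d ω - y b ω * y c ω) P :=
    h1.sub (h b c)
  rw [integral_add h2 (h a c), integral_sub h1 (h b c), integral_sub (h b d) (h a d)]
  rfl

lemma integral_riemannSum_sq (hy : ∀ t, MemLp (y t) 2 P) (f : ℝ → ℝ) (n : ℕ) (p ξ : ℕ → ℝ) :
    ∫ ω, riemannSum y f n p ξ ω ^ 2 ∂P = ∑ i ∈ Finset.range n, ∑ j ∈ Finset.range n,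
      f (ξ i) * f (ξ j) * rectInc (covFun P y) (p i) (p (i + 1)) (p j) (p (j + 1)) := by
  have hint : ∀ i j, Integrable (fun ω => f (ξ i) * (y (p (i + 1)) ω - y (p i) ω) *
      (f (ξ j) * (y (p (j + 1)) ω - y (p j) ω))) P := fun i j =>
    (((hy (p (i + 1))).sub (hy (p i))).const_mul (f (ξ i))).integrable_mul
      (((hy (p (j + 1))).sub (hy (p j))).const_mul (f (ξ j)))
  simp_rw [riemannSum, sq, Finset.sum_mul_sum]
  rw [integral_finsetSum _ fun i _ => integrable_finsetSum _ fun j _ => hint i j]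
  refine Finset.sum_congr rfl fun i _ => ?_
  rw [integral_finsetSum _ fun j _ => hint i j]
  refine Finset.sum_congr rfl fun j _ => ?_
  rw [rectInc_covFun hy, ← integral_const_mul]
  exact integral_congr_ae (Eventually.of_forall fun ω => by ring)

/-- If every tag minimizes `G` on its cell, then the sum of `G ⊗ G` against the variation of the
covariance is one of the lower sums whose supremum is `absIntegral`. -/
lemma eLpNorm_riemannSum_le (hy : ∀ t, MemLp (y t) 2 P) {f G : ℝ → ℝ} {ρ : ℝ} (hρ : 0 ≤ ρ)
    (hG : ∀ l, 0 ≤ G l) (hf : ∀ l, |f l| ≤ ρ * G l)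
    (hI : absIntegral (covFun P y) (fun l m => ENNReal.ofReal (G l * G m)) ≠ ⊤)
    {n : ℕ} {p ξ : ℕ → ℝ} (hp : Monotone p)
    (hξ : ∀ i < n, ∀ l ∈ Icc (p i) (p (i + 1)), G (ξ i) ≤ G l) :
    eLpNorm (riemannSum y f n p ξ) 2 P ≤ ENNReal.ofReal (ρ * Real.sqrt
      (absIntegral (covFun P y) (fun l m => ENNReal.ofReal (G l * G m))).toReal) := by
  set R : ℕ → ℕ → ℝ := fun i j => rectInc (covFun P y) (p i) (p (i + 1)) (p j) (p (j + 1))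
  set I := absIntegral (covFun P y) (fun l m => ENNReal.ofReal (G l * G m)) with hIdef
  have hlow : ENNReal.ofReal (∑ i ∈ Finset.range n, ∑ j ∈ Finset.range n,
      G (ξ i) * G (ξ j) * |R i j|) ≤ I := by
    have hnn : ∀ i j, 0 ≤ G (ξ i) * G (ξ j) * |R i j| := fun i j =>
      mul_nonneg (mul_nonneg (hG _) (hG _)) (abs_nonneg _)
    rw [ENNReal.ofReal_sum_of_nonneg fun i _ => Finset.sum_nonneg fun j _ => hnn i j]
    refine le_trans ?_ (le_iSup₂ (f := fun (p q : ℕ × {p : ℕ → ℝ // Monotone p}) =>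
      ∑ i ∈ Finset.range p.1, ∑ j ∈ Finset.range q.1,
      (⨅ (l ∈ Icc (p.2.1 i) (p.2.1 (i + 1))) (m ∈ Icc (q.2.1 j) (q.2.1 (j + 1))),
        ENNReal.ofReal (G l * G m)) *
      ENNReal.ofReal |rectInc (covFun P y) (p.2.1 i) (p.2.1 (i + 1)) (q.2.1 j) (q.2.1 (j + 1))|)
      (n, ⟨p, hp⟩) (n, ⟨p, hp⟩))
    refine Finset.sum_le_sum fun i hi => ?_
    rw [ENNReal.ofReal_sum_of_nonneg fun j _ => hnn i j]
    refine Finset.sum_le_sum fun j hj => ?_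
    rw [ENNReal.ofReal_mul (mul_nonneg (hG _) (hG _))]
    gcongr
    refine le_iInf₂ fun l hl => le_iInf₂ fun m hm => ENNReal.ofReal_le_ofReal ?_
    exact mul_le_mul (hξ i (Finset.mem_range.1 hi) l hl) (hξ j (Finset.mem_range.1 hj) m hm)
      (hG _) (hG _)
  rw [eLpNorm_two_eq_sqrt (memLp_riemannSum hy f n p ξ), integral_riemannSum_sq hy]
  refine ENNReal.ofReal_le_ofReal ((Real.sqrt_le_left (by positivity)).2 ?_)
  rw [mul_pow, Real.sq_sqrt ENNReal.toReal_nonneg]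
  calc ∑ i ∈ Finset.range n, ∑ j ∈ Finset.range n, f (ξ i) * f (ξ j) * R i j
      ≤ ∑ i ∈ Finset.range n, ∑ j ∈ Finset.range n, ρ ^ 2 * (G (ξ i) * G (ξ j) * |R i j|) := by
        refine Finset.sum_le_sum fun i _ => Finset.sum_le_sum fun j _ => ?_
        calc f (ξ i) * f (ξ j) * R i j ≤ |f (ξ i)| * |f (ξ j)| * |R i j| := by
              rw [← abs_mul, ← abs_mul]; exact le_abs_self _
          _ ≤ (ρ * G (ξ i)) * (ρ * G (ξ j)) * |R i j| := by
              gcongr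
              · exact mul_nonneg hρ (hG _)
              · exact hf _
              · exact hf _
          _ = _ := by ring
    _ = ρ ^ 2 * ∑ i ∈ Finset.range n, ∑ j ∈ Finset.range n, G (ξ i) * G (ξ j) * |R i j| := by
        simp_rw [Finset.mul_sum]
    _ ≤ ρ ^ 2 * I.toReal := by
        gcongr
        exact (ENNReal.ofReal_le_iff_le_toReal hI).1 hlow

lemma HasMSIntegralOn.sub (hy : ∀ t, MemLp (y t) 2 P) {f g : ℝ → ℝ} {a b : ℝ} {J L : Ω → ℝ}
    (hf : HasMSIntegralOn P y f a b J) (hg : HasMSIntegralOn P y g a b L) :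
    HasMSIntegralOn P y (fun l => f l - g l) a b (fun ω => J ω - L ω) := by
  refine ⟨hf.1.sub hg.1, fun ε hε => ?_⟩
  have hε2 : 0 < ε / 2 := ENNReal.half_pos hε.ne'
  obtain ⟨δ₁, hδ₁, h₁⟩ := hf.2 (ε / 2) hε2
  obtain ⟨δ₂, hδ₂, h₂⟩ := hg.2 (ε / 2) hε2
  refine ⟨min δ₁ δ₂, lt_min hδ₁ hδ₂, fun n p ξ hp hpa hpb hmesh hξ => ?_⟩
  have e₁ := h₁ n p ξ hp hpa hpb (fun i hi => (hmesh i hi).trans_le (min_le_left _ _)) hξ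
  have e₂ := h₂ n p ξ hp hpa hpb (fun i hi => (hmesh i hi).trans_le (min_le_right _ _)) hξ
  have hs := eLpNorm_sub_le
    ((memLp_riemannSum hy f n p ξ).sub hf.1).aestronglyMeasurable
    ((memLp_riemannSum hy g n p ξ).sub hg.1).aestronglyMeasurable (p := 2) one_le_two
  refine (le_of_eq ?_).trans (hs.trans ((add_le_add e₁ e₂).trans_eq (ENNReal.add_halves ε)))
  congr 1
  funext ω
  simp only [Pi.sub_apply, riemannSum, sub_mul, Finset.sum_sub_distrib]
  ring

lemma HasMSIntegral.sub (hy : ∀ t, MemLp (y t) 2 P) {f g : ℝ → ℝ} {J L : Ω → ℝ}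
    (hf : HasMSIntegral P y f J) (hg : HasMSIntegral P y g L) :
    HasMSIntegral P y (fun l => f l - g l) (fun ω => J ω - L ω) := by
  obtain ⟨hJ, K₁, hK₁, hT₁⟩ := hf
  obtain ⟨hL, K₂, hK₂, hT₂⟩ := hg
  refine ⟨hJ.sub hL, fun a b ω => K₁ a b ω - K₂ a b ω,
    fun a b hab => (hK₁ a b hab).sub hy (hK₂ a b hab), ?_⟩
  have hT := hT₁.add hT₂
  rw [add_zero] at hT
  refine tendsto_of_tendsto_of_tendsto_of_le_of_le' tendsto_const_nhds hT
    (Eventually.of_forall fun _ => zero_le) ?_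
  filter_upwards [prod_mem_prod (Iic_mem_atBot (0 : ℝ)) (Ici_mem_atTop (0 : ℝ))] with q hq
  have hq' : q.1 ≤ q.2 := le_trans hq.1 hq.2
  refine (le_of_eq ?_).trans (eLpNorm_sub_le ((hK₁ _ _ hq').1.sub hJ).aestronglyMeasurable
    ((hK₂ _ _ hq').1.sub hL).aestronglyMeasurable one_le_two)
  congr 1
  funext ω
  simp only [Pi.sub_apply]
  ring

/-- A mean-square integral is approximated by Riemann–Stieltjes sums whose tags minimize a given
continuous function on the cells. -/
lemma HasMSIntegral.exists_riemannSum (hy : ∀ t, MemLp (y t) 2 P) {f G : ℝ → ℝ} {J : Ω → ℝ}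
    (hf : HasMSIntegral P y f J) (hG : Continuous G) {ε : ℝ≥0∞} (hε : 0 < ε) :
    ∃ (n : ℕ) (p ξ : ℕ → ℝ), Monotone p ∧
      (∀ i < n, ∀ l ∈ Icc (p i) (p (i + 1)), G (ξ i) ≤ G l) ∧
      eLpNorm (riemannSum y f n p ξ - J) 2 P ≤ ε := by
  obtain ⟨hJ, K, hK, hT⟩ := hf
  have hε2 : 0 < ε / 2 := ENNReal.half_pos hε.ne'
  obtain ⟨q, hq, hqε⟩ := ((eventually_mem_set.2
    (prod_mem_prod (Iic_mem_atBot (0 : ℝ)) (Ici_mem_atTop (0 : ℝ)))).and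
    (hT.eventually_le_const hε2)).exists
  have hab : q.1 ≤ q.2 := le_trans hq.1 hq.2
  obtain ⟨hKm, hKδ⟩ := hK q.1 q.2 hab
  obtain ⟨δ, hδ, h⟩ := hKδ (ε / 2) hε2
  obtain ⟨n, hn⟩ := exists_nat_gt ((q.2 - q.1) / δ)
  have hn0 : (0 : ℝ) < n := (div_nonneg (sub_nonneg.2 hab) hδ.le).trans_lt hn
  set p : ℕ → ℝ := fun i => q.1 + (q.2 - q.1) / n * (min i n : ℕ) with hp
  have hpm : Monotone p := by
    intro i j hij
    have : ((min i n : ℕ) : ℝ) ≤ (min j n : ℕ) := by exact_mod_cast min_le_min_right n hij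
    have h0 : 0 ≤ (q.2 - q.1) / n := div_nonneg (sub_nonneg.2 hab) hn0.le
    simp only [hp]
    gcongr
  have hmin : ∀ i, ∃ x ∈ Icc (p i) (p (i + 1)), IsMinOn G (Icc (p i) (p (i + 1))) x := fun i =>
    isCompact_Icc.exists_isMinOn (nonempty_Icc.2 (hpm (Nat.le_succ i))) hG.continuousOn
  choose ξ hξ hξm using hmin
  refine ⟨n, p, ξ, hpm, fun i _ l hl => hξm i hl, ?_⟩
  have e₁ := h n p ξ hpm (by simp [hp]) (by simp only [hp, min_self]; field_simp; ring) (by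
    intro i hi
    simp only [hp, min_eq_left hi.le, min_eq_left (Nat.succ_le_of_lt hi)]
    push_cast
    rw [div_lt_iff₀ hδ] at hn
    have : (q.2 - q.1) / n < δ := by rw [div_lt_iff₀ hn0]; linarith
    linarith) (fun i _ => hξ i)
  refine (le_of_eq ?_).trans ((eLpNorm_add_le
    ((memLp_riemannSum hy f n p ξ).sub hKm).aestronglyMeasurable
    (hKm.sub hJ).aestronglyMeasurable one_le_two).trans
      ((add_le_add e₁ hqε).trans_eq (ENNReal.add_halves ε)))
  congr 1
  funext ω
  simp

/-- The energy estimate: if `|f| ≤ ρ G`, then `‖∫ f dy‖₂² ≤ ρ² ∬ G(l) G(m) d|Γ(l, m)|`. -/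
lemma HasMSIntegral.eLpNorm_le (hy : ∀ t, MemLp (y t) 2 P) {f G : ℝ → ℝ} {J : Ω → ℝ}
    (hfJ : HasMSIntegral P y f J) (hGc : Continuous G) {ρ : ℝ} (hρ : 0 ≤ ρ)
    (hG : ∀ l, 0 ≤ G l) (hf : ∀ l, |f l| ≤ ρ * G l)
    (hI : absIntegral (covFun P y) (fun l m => ENNReal.ofReal (G l * G m)) ≠ ⊤) :
    eLpNorm J 2 P ≤ ENNReal.ofReal (ρ * Real.sqrt
      (absIntegral (covFun P y) (fun l m => ENNReal.ofReal (G l * G m))).toReal) := by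
  refine le_of_forall_pos_le_add fun ε hε => ?_
  obtain ⟨n, p, ξ, hp, hξ, hR⟩ := hfJ.exists_riemannSum hy hGc hε
  have hm := memLp_riemannSum hy f n p ξ
  calc eLpNorm J 2 P = eLpNorm (riemannSum y f n p ξ - (riemannSum y f n p ξ - J)) 2 P := by
        rw [sub_sub_cancel]
    _ ≤ _ := eLpNorm_sub_le hm.aestronglyMeasurable (hm.sub hfJ.1).aestronglyMeasurable one_le_two
    _ ≤ _ := add_le_add (eLpNorm_riemannSum_le hy hρ hG hf hI hp hξ) hR

/-- Mean-square integrals inherit the strict sub-Gaussian bound of the integrator. -/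
lemma HasMSIntegral.subExp (hφ : IsNFunction φ) {C : ℝ} (hy : IsStrictlyPhiSubProcess P φ y C)
    {f : ℝ → ℝ} {J : Ω → ℝ} (hf : HasMSIntegral P y f J) :
    SubExp P φ J (C * (eLpNorm J 2 P).toReal) := by
  have hy2 : ∀ t, MemLp (y t) 2 P := fun t => (hy.mem _ (mem_range_self t)).memLp_two
  have hex : ∀ k : ℕ, ∃ S : Ω → ℝ, MemLp S 2 P ∧ SubExp P φ S (C * (eLpNorm S 2 P).toReal) ∧
      eLpNorm (S - J) 2 P ≤ ENNReal.ofReal (1 / ((k : ℝ) + 1)) := by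
    intro k
    obtain ⟨n, p, ξ, _, _, hR⟩ := hf.exists_riemannSum hy2 (continuous_const (y := (0 : ℝ)))
      (ENNReal.ofReal_pos.2 (Nat.one_div_pos_of_nat (n := k)))
    refine ⟨_, memLp_riemannSum hy2 f n p ξ, ?_, hR⟩
    rw [riemannSum_eq_sum_range]
    exact IsStrictlyPhiSubFamily.subExp_sum hφ hy (2 * n) (fun j => y (p ((j + 1) / 2))) _
      fun j => mem_range_self _
  choose S hS hSe hSJ using hex
  have h0 : Tendsto (fun k : ℕ => 1 / ((k : ℝ) + 1)) atTop (𝓝 0) :=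
    tendsto_one_div_add_atTop_nhds_zero_nat
  refine SubExp.of_tendsto hφ (fun n => (hS n).aestronglyMeasurable) hf.1.aestronglyMeasurable
    (a := fun k => C * ((eLpNorm J 2 P).toReal + 1 / ((k : ℝ) + 1))) ?_ ?_ ?_
  · have := ENNReal.tendsto_ofReal h0
    rw [ENNReal.ofReal_zero] at this
    exact tendsto_of_tendsto_of_tendsto_of_le_of_le tendsto_const_nhds this
      (fun _ => zero_le) hSJ
  · simpa using (h0.const_add (eLpNorm J 2 P).toReal).const_mul C
  · intro k
    refine (hSe k).mono hφ (mul_nonneg hy.nonneg ENNReal.toReal_nonneg)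
      (mul_le_mul_of_nonneg_left ?_ hy.nonneg)
    have hk : (0 : ℝ) ≤ 1 / ((k : ℝ) + 1) := Nat.one_div_pos_of_nat.le
    have : eLpNorm (S k) 2 P ≤ eLpNorm J 2 P + ENNReal.ofReal (1 / ((k : ℝ) + 1)) := by
      have h := eLpNorm_add_le ((hS k).sub hf.1).aestronglyMeasurable
        hf.1.aestronglyMeasurable (p := 2) one_le_two
      rw [sub_add_cancel] at h
      exact h.trans ((add_le_add_left (hSJ k) _).trans_eq (add_comm _ _))
    refine (ENNReal.toReal_mono (by simp [hf.1.eLpNorm_ne_top]) this).trans_eq ?_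
    rw [ENNReal.toReal_add hf.1.eLpNorm_ne_top ENNReal.ofReal_ne_top, ENNReal.toReal_ofReal hk]

end MeanSquare

/-! ### Admissible functions and the increments of the field -/

namespace IsAdmissible

variable {φ Z : ℝ → ℝ} {u₀ : ℝ} (hZ : IsAdmissible φ Z u₀)
include hZ

lemma map_zero_nonneg : 0 ≤ Z 0 := by
  have h : Tendsto Z (𝓝[>] 0) (𝓝 (Z 0)) :=
    (hZ.continuousOn 0 self_mem_Ici).mono_left (nhdsWithin_mono _ Ioi_subset_Ici_self)
  refine ge_of_tendsto h ?_
  filter_upwards [self_mem_nhdsWithin] with v hv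
  exact (hZ.pos v hv).le

lemma map_nonneg {v : ℝ} (hv : 0 ≤ v) : 0 ≤ Z v :=
  hZ.map_zero_nonneg.trans (hZ.strictMonoOn.monotoneOn self_mem_Ici hv hv)

/-- The inequality behind `|sin(h v)| ≤ Z(v + u₀) / Z(1 / h + u₀)`. -/
lemma min_one_mul_le {h v : ℝ} (hh : 0 < h) (hv : 0 ≤ v) :
    min 1 (h * v) ≤ Z (v + u₀) / Z (1 / h + u₀) := by
  have hu := hZ.nonneg
  have hh' : 0 < 1 / h := by positivity
  have hpos : 0 < Z (1 / h + u₀) := hZ.pos _ (by linarith)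
  rw [le_div_iff₀ hpos]
  rcases le_total (1 / h) v with hle | hle
  · have h1 : Z (1 / h + u₀) ≤ Z (v + u₀) :=
      hZ.strictMonoOn.monotoneOn (mem_Ici.2 (by linarith)) (mem_Ici.2 (by linarith)) (by linarith)
    have h2 : min 1 (h * v) ≤ 1 := min_le_left _ _
    nlinarith
  · rcases eq_or_lt_of_le hv with rfl | hv0
    · simpa using hZ.map_nonneg hu
    have hposv : 0 < Z (v + u₀) := hZ.pos _ (by linarith)
    have h1 := hZ.monotoneOn_div (mem_Ioi.2 (by linarith : u₀ < v + u₀))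
      (mem_Ioi.2 (by linarith : u₀ < 1 / h + u₀)) (by linarith)
    rw [div_le_div_iff₀ hposv hpos] at h1
    have h2 : h * v ≤ 1 := by rw [le_div_iff₀ hh] at hle; linarith
    have h3 : h * (1 / h + u₀) = 1 + h * u₀ := by field_simp
    have h4 : min 1 (h * v) ≤ h * v := min_le_right _ _
    -- `h v (1/h + u₀) ≤ v + u₀` since `h v ≤ 1`
    have h5 : h * v * (1 / h + u₀) ≤ v + u₀ := by
      have : h * v * (1 / h + u₀) = v + h * v * u₀ := by field_simp
      nlinarith
    have h6 : (v + u₀) * Z (1 / h + u₀) ≤ Z (v + u₀) * (1 / h + u₀) := by linarith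
    have h7 : h * v * Z (1 / h + u₀) * (1 / h + u₀) ≤ Z (v + u₀) * (1 / h + u₀) := by nlinarith
    have h8 : h * v * Z (1 / h + u₀) ≤ Z (v + u₀) := le_of_mul_le_mul_right h7 (by linarith)
    nlinarith

lemma continuous_zWeight (N : ℕ) (a : ℕ → ℝ) : Continuous (zWeight Z u₀ N a) := by
  have hs : Continuous (symb N a) := by
    unfold symb
    fun_prop
  have hu := hZ.nonneg
  refine Continuous.add ?_ ?_
  · exact hZ.continuousOn.comp_continuous (by fun_prop) fun l => mem_Ici.2 (by positivity)
  · exact hZ.continuousOn.comp_continuous (by fun_prop) fun l => mem_Ici.2 (by positivity)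

lemma two_mul_le_zWeight (N : ℕ) (a : ℕ → ℝ) (l : ℝ) : 2 * Z u₀ ≤ zWeight Z u₀ N a l := by
  have hu := hZ.nonneg
  have h1 : Z u₀ ≤ Z (|l| / 2 + u₀) := hZ.strictMonoOn.monotoneOn hu
    (mem_Ici.2 (by positivity)) (by linarith [abs_nonneg l])
  have h2 : Z u₀ ≤ Z (1 / 2 * |symb N a l| + u₀) := hZ.strictMonoOn.monotoneOn hu
    (mem_Ici.2 (by positivity)) (by linarith [abs_nonneg (symb N a l)])
  unfold zWeight
  linarith

lemma zWeight_nonneg (N : ℕ) (a : ℕ → ℝ) (l : ℝ) : 0 ≤ zWeight Z u₀ N a l := by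
  linarith [hZ.two_mul_le_zWeight N a l, hZ.map_nonneg hZ.nonneg]

lemma abs_kernelI_sub_le {κ : ℝ → ℝ} (hκ : κ = Real.cos ∨ κ = Real.sin) (N : ℕ) (a : ℕ → ℝ)
    {h t x t' x' : ℝ} (hh : 0 < h) (hx : |x - x'| ≤ h) (ht : |t - t'| ≤ h) (l : ℝ) :
    |kernelI κ N a t x l - kernelI κ N a t' x' l| ≤
      2 / Z (1 / h + u₀) * zWeight Z u₀ N a l := by
  have hκ2 : ∀ α β, |κ α - κ β| ≤ 2 ∧ |κ α - κ β| ≤ |α - β| := by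
    intro α β
    rcases hκ with rfl | rfl
    · refine ⟨(abs_sub _ _).trans ?_, Real.abs_cos_sub_cos_le α β⟩
      linarith [Real.abs_cos_le_one α, Real.abs_cos_le_one β]
    · refine ⟨(abs_sub _ _).trans ?_, Real.abs_sin_sub_sin_le α β⟩
      linarith [Real.abs_sin_le_one α, Real.abs_sin_le_one β]
  obtain ⟨h1, h2⟩ := hκ2 (l * x + t * symb N a l) (l * x' + t' * symb N a l)
  have h3 : |(l * x + t * symb N a l) - (l * x' + t' * symb N a l)| ≤
      h * |l| + h * |symb N a l| := by
    rw [show (l * x + t * symb N a l) - (l * x' + t' * symb N a l) =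
      (x - x') * l + (t - t') * symb N a l by ring]
    refine (abs_add_le _ _).trans ?_
    rw [abs_mul, abs_mul]
    gcongr
  have e1 := hZ.min_one_mul_le hh (v := |l| / 2) (by positivity)
  have e2 := hZ.min_one_mul_le hh (v := 1 / 2 * |symb N a l|) (by positivity)
  have hsum : 2 / Z (1 / h + u₀) * zWeight Z u₀ N a l =
      2 * (Z (|l| / 2 + u₀) / Z (1 / h + u₀) +
        Z (1 / 2 * |symb N a l| + u₀) / Z (1 / h + u₀)) := by
    unfold zWeight
    ring
  rw [hsum]
  have hl : 0 ≤ h * (|l| / 2) := by positivity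
  have hs : 0 ≤ h * (1 / 2 * |symb N a l|) := by positivity
  have hmin : |kernelI κ N a t x l - kernelI κ N a t' x' l| / 2 ≤
      min 1 (h * (|l| / 2)) + min 1 (h * (1 / 2 * |symb N a l|)) := by
    unfold kernelI
    rcases min_cases 1 (h * (|l| / 2)) with hm | hm <;>
      rcases min_cases 1 (h * (1 / 2 * |symb N a l|)) with hm' | hm' <;> linarith
  linarith

end IsAdmissible

section Field

variable {Ω : Type*} [MeasurableSpace Ω] {P : Measure Ω} {φ Z : ℝ → ℝ} {u₀ : ℝ}
  {y : ℝ → Ω → ℝ} {N : ℕ} {a : ℕ → ℝ} {κ : ℝ → ℝ}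

/-- The modulus of continuity of the field in mean square. -/
lemma eLpNorm_sub_le_of_abs_le (hZ : IsAdmissible φ Z u₀) (hy : ∀ t, MemLp (y t) 2 P)
    (hκ : κ = Real.cos ∨ κ = Real.sin) (hCZ : CZsq P y Z u₀ N a ≠ ⊤)
    {h t x t' x' : ℝ} (hh : 0 < h) (hx : |x - x'| ≤ h) (ht : |t - t'| ≤ h) {J J' : Ω → ℝ}
    (hJ : HasMSIntegral P y (kernelI κ N a t x) J)
    (hJ' : HasMSIntegral P y (kernelI κ N a t' x') J') :
    eLpNorm (fun ω => J ω - J' ω) 2 P ≤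
      ENNReal.ofReal (2 / Z (1 / h + u₀) * CZ P y Z u₀ N a) :=
  (hJ.sub hy hJ').eLpNorm_le hy (hZ.continuous_zWeight N a)
    (div_nonneg zero_le_two (hZ.map_nonneg (add_nonneg (by positivity) hZ.nonneg)))
    (hZ.zWeight_nonneg N a) (hZ.abs_kernelI_sub_le hκ N a hh hx ht) hCZ

lemma eLpNorm_field_le (hZ : IsAdmissible φ Z u₀) (hy : ∀ t, MemLp (y t) 2 P)
    (hκ : κ = Real.cos ∨ κ = Real.sin) (hCZ : CZsq P y Z u₀ N a ≠ ⊤) (hZu : 0 < Z u₀)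
    {t x : ℝ} {J : Ω → ℝ} (hJ : HasMSIntegral P y (kernelI κ N a t x) J) :
    eLpNorm J 2 P ≤ ENNReal.ofReal (1 / (2 * Z u₀) * CZ P y Z u₀ N a) := by
  refine hJ.eLpNorm_le hy (hZ.continuous_zWeight N a) (by positivity)
    (hZ.zWeight_nonneg N a) (fun l => ?_) hCZ
  have h1 : |kernelI κ N a t x l| ≤ 1 := by
    rcases hκ with rfl | rfl
    · exact Real.abs_cos_le_one _
    · exact Real.abs_sin_le_one _
  have := hZ.two_mul_le_zWeight N a l
  rw [div_mul_eq_mul_div, le_div_iff₀ (by positivity)]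
  nlinarith

end Field

/-! ### Chaining -/

section Chaining

variable {Ω : Type*} [MeasurableSpace Ω] {P : Measure Ω} [IsProbabilityMeasure P] {φ : ℝ → ℝ}

/-- Hölder's inequality on a probability space, with exponents of total weight at most one. -/
lemma lintegral_prod_rpow_le {ι : Type*} (s : Finset ι) {f : ι → Ω → ℝ≥0∞}
    (hf : ∀ i ∈ s, AEMeasurable (f i) P) {p : ι → ℝ} (hp : ∀ i ∈ s, 0 ≤ p i)
    (hp1 : ∑ i ∈ s, p i ≤ 1) :
    ∫⁻ ω, ∏ i ∈ s, f i ω ^ p i ∂P ≤ ∏ i ∈ s, (∫⁻ ω, f i ω ∂P) ^ p i := by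
  -- the missing weight is carried by the constant function `1`
  have := ENNReal.lintegral_prod_norm_pow_le (μ := P) (Finset.insertNone s)
    (f := fun o => o.elim (fun _ => 1) f) (p := fun o => o.elim (1 - ∑ i ∈ s, p i) p)
    (by
      rintro (_ | i) hi
      · exact aemeasurable_const
      · exact hf i (by simpa using hi))
    (by simp)
    (by
      rintro (_ | i) hi
      · simpa using hp1
      · exact hp i (by simpa using hi))
  simpa using this

omit [IsProbabilityMeasure P] in
lemma SubExp.lintegral_sum_exp_le {ι : Type*} {F : Finset ι} {D : ι → Ω → ℝ}
    (hD : ∀ t ∈ F, AEMeasurable (D t) P) {e μ H : ℝ} (hF : (F.card : ℝ) ≤ Real.exp H)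
    (hDe : ∀ t ∈ F, SubExp P φ (D t) e) (hφ : IsNFunction φ) :
    ∫⁻ ω, ∑ t ∈ F, (ENNReal.ofReal (Real.exp (μ * D t ω)) +
      ENNReal.ofReal (Real.exp (-μ * D t ω))) ∂P ≤
      ENNReal.ofReal (Real.exp (Real.log 2 + φ (e * μ) + H)) := by
  have hm : ∀ t ∈ F, ∀ μ : ℝ, AEMeasurable (fun ω => ENNReal.ofReal (Real.exp (μ * D t ω))) P :=
    fun t ht μ => (Real.measurable_exp.comp_aemeasurable ((hD t ht).const_mul μ)).ennreal_ofReal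
  have hm2 : ∀ t ∈ F, AEMeasurable (fun ω => ENNReal.ofReal (Real.exp (μ * D t ω)) +
      ENNReal.ofReal (Real.exp (-μ * D t ω))) P := fun t ht => (hm t ht μ).add (hm t ht (-μ))
  rw [lintegral_finsetSum' F hm2]
  calc ∑ t ∈ F, ∫⁻ ω, (ENNReal.ofReal (Real.exp (μ * D t ω)) +
        ENNReal.ofReal (Real.exp (-μ * D t ω))) ∂P
      ≤ ∑ _t ∈ F, ENNReal.ofReal (2 * Real.exp (φ (e * μ))) := by
        refine Finset.sum_le_sum fun t ht => ?_
        rw [lintegral_add_left' (hm t ht μ), two_mul,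
          ENNReal.ofReal_add (Real.exp_nonneg _) (Real.exp_nonneg _)]
        refine add_le_add (hDe t ht μ) ((hDe t ht (-μ)).trans_eq ?_)
        rw [mul_neg, hφ.even]
    _ = ENNReal.ofReal (F.card * (2 * Real.exp (φ (e * μ)))) := by
        rw [Finset.sum_const, nsmul_eq_mul, ENNReal.ofReal_mul (Nat.cast_nonneg _),
          ENNReal.ofReal_natCast]
    _ ≤ _ := by
        refine ENNReal.ofReal_le_ofReal ?_
        rw [Real.exp_add, Real.exp_add, Real.exp_log two_pos, mul_comm]
        gcongr

/-- Tail bound by chaining along finite nets. The points of `D` are approximated in mean square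
by points of the nets `F n`; the links of the chain at level `k` satisfy an exponential bound with
constant `ε θ^k`, and `F k` has at most `exp(H k)` points.

Hölder's inequality is applied to the links with exponents
`q k = φ⁽⁻¹⁾(φ(l ε / (1 - θ)) + H k) / (l ε θ^k)`. For this choice the exponential moments of the
level `k` and its number of points balance: each level costs a factor
`2 exp(φ(l ε / (1 - θ)) + 2 H k)` to the power `1 / q k`, while `∑ 1 / q k ≤ 1` and
`H k / q k ≤ l ε θ^k Ψ(H k)`. -/
lemma measure_exists_lt_abs_le {ι : Type*} (hφ : IsNFunction φ) {X : ι → Ω → ℝ}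
    (hX : ∀ t, AEMeasurable (X t) P) {θ ε l : ℝ} (hθ0 : 0 < θ) (hθ1 : θ < 1) (hε : 0 < ε)
    (hl : 0 < l) {F : ℕ → Finset ι} (hFne : ∀ k, (F k).Nonempty) {H : ℕ → ℝ} (hH : ∀ k, 0 ≤ H k)
    (hF : ∀ k, ((F k).card : ℝ) ≤ Real.exp (H k)) {π : ℕ → ι → ι}
    (hπ : ∀ k, ∀ t ∈ F (k + 1), π k t ∈ F k) (h0 : ∀ t ∈ F 0, SubExp P φ (X t) ε)
    (h1 : ∀ k, ∀ t ∈ F (k + 1),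
      SubExp P φ (fun ω => X t ω - X (π k t) ω) (ε * θ ^ (k + 1)))
    {B : ℝ} (hB : ∀ n, ∑ k ∈ Finset.range n, ε * θ ^ k * Psi φ (H k) ≤ B)
    {D : Set ι} (hD : D.Countable) {α : ℕ → ι → ι} (hα : ∀ n, ∀ t ∈ D, α n t ∈ F n)
    (hαt : ∀ t ∈ D, Tendsto (fun n => eLpNorm (X (α n t) - X t) 2 P) atTop (𝓝 0)) (w : ℝ) :
    P {ω | ∃ t ∈ D, w < |X t ω|} ≤
      ENNReal.ofReal (2 * Real.exp (φ (l * ε / (1 - θ)) + 2 * l * B - l * w)) := by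
  have hθ' : 0 < 1 - θ := sub_pos.2 hθ1
  set c := φ (l * ε / (1 - θ)) with hc
  have hx0 : 0 < l * ε / (1 - θ) := by positivity
  have hc0 : 0 < c := hφ.pos _ hx0.ne'
  have hic : inv φ c = l * ε / (1 - θ) := inv_apply hφ.strictMonoOn hx0.le
  have hi0 : ∀ k, 0 < inv φ (c + H k) := fun k => hφ.inv_pos (by linarith [hH k])
  set p : ℕ → ℝ := fun k => l * ε * θ ^ k / inv φ (c + H k) with hp
  have hp0 : ∀ k, 0 < p k := fun k => div_pos (by positivity) (hi0 k)
  have hpsum : ∀ n, ∑ k ∈ Finset.range n, p k ≤ 1 := by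
    intro n
    calc ∑ k ∈ Finset.range n, p k ≤ ∑ k ∈ Finset.range n, (1 - θ) * θ ^ k := by
          refine Finset.sum_le_sum fun k _ => ?_
          rw [hp]
          have hle : l * ε / (1 - θ) ≤ inv φ (c + H k) :=
            hic ▸ hφ.inv_mono (by linarith [hH k])
          rw [div_le_iff₀ (hi0 k)]
          rw [div_le_iff₀ hθ'] at hle
          nlinarith [pow_pos hθ0 k]
      _ = 1 - θ ^ n := by rw [← Finset.mul_sum, mul_neg_geom_sum]
      _ ≤ 1 := by linarith [pow_pos hθ0 n]
  -- the links of the chains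
  set L : ℕ → ι → Ω → ℝ := fun k t ω =>
    match k with
    | 0 => X t ω
    | k + 1 => X t ω - X (π k t) ω with hL
  have hLm : ∀ k t, AEMeasurable (L k t) P := by
    rintro (_ | k) t
    · exact hX t
    · exact (hX t).sub (hX (π k t))
  have hLs : ∀ k, ∀ t ∈ F k, SubExp P φ (L k t) (ε * θ ^ k) := by
    rintro (_ | k) t ht
    · simpa using h0 t ht
    · exact h1 k t ht
  set f : ℕ → Ω → ℝ≥0∞ := fun k ω => ∑ t ∈ F k,
    (ENNReal.ofReal (Real.exp (l / p k * L k t ω)) +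
      ENNReal.ofReal (Real.exp (-(l / p k) * L k t ω))) with hf
  have hfm : ∀ k, AEMeasurable (f k) P := fun k => Finset.aemeasurable_fun_sum _ fun t _ =>
    (Real.measurable_exp.comp_aemeasurable ((hLm k t).const_mul _)).ennreal_ofReal.add
      (Real.measurable_exp.comp_aemeasurable ((hLm k t).const_mul _)).ennreal_ofReal
  have hfint : ∀ k, ∫⁻ ω, f k ω ∂P ≤
      ENNReal.ofReal (Real.exp (Real.log 2 + c + 2 * H k)) := by
    intro k
    refine (SubExp.lintegral_sum_exp_le (fun t _ => hLm k t) (hF k) (hLs k) hφ).trans_eq ?_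
    have : ε * θ ^ k * (l / p k) = inv φ (c + H k) := by
      have := (hi0 k).ne'
      simp only [hp]
      field_simp
    rw [this, hφ.apply_inv (by linarith [hH k])]
    ring_nf
  have hlink : ∀ k, ∀ t ∈ F k, ∀ ω,
      ENNReal.ofReal (Real.exp (l * |L k t ω|)) ≤ f k ω ^ p k := by
    intro k t ht ω
    have hle : ENNReal.ofReal (Real.exp (l / p k * |L k t ω|)) ≤ f k ω := by
      refine le_trans ?_ (Finset.single_le_sum (f := fun t =>
        (ENNReal.ofReal (Real.exp (l / p k * L k t ω)) +
        ENNReal.ofReal (Real.exp (-(l / p k) * L k t ω)))) (fun _ _ => zero_le) ht)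
      rcases abs_choice (L k t ω) with h | h <;> rw [h]
      · exact le_self_add
      · rw [mul_neg, ← neg_mul]
        exact le_add_self
    refine le_trans (le_of_eq ?_) (ENNReal.rpow_le_rpow hle (hp0 k).le)
    rw [ENNReal.ofReal_rpow_of_pos (Real.exp_pos _), ← Real.exp_mul]
    congr 2
    have := (hp0 k).ne'
    field_simp
  have hf1 : ∀ k ω, 1 ≤ f k ω ^ p k := by
    intro k ω
    obtain ⟨t, ht⟩ := hFne k
    refine le_trans ?_ (hlink k t ht ω)
    rw [← ENNReal.ofReal_one]
    exact ENNReal.ofReal_le_ofReal (Real.one_le_exp (by positivity))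
  -- the products increase with `n` because each factor is at least `1`, so that a subsequence of
  -- approximating points, depending on `t`, is enough to bound `exp(l |X t|)` by their supremum
  set g : ℕ → Ω → ℝ≥0∞ := fun n ω => ∏ k ∈ Finset.range (n + 1), f k ω ^ p k with hg
  have hgm : ∀ n, AEMeasurable (g n) P := fun n =>
    Finset.aemeasurable_fun_prod _ fun k _ => (hfm k).pow_const _
  have hgmono : ∀ ω, Monotone fun n => g n ω := fun ω => monotone_nat_of_le_succ fun n => by
    simp only [hg]
    rw [Finset.prod_range_succ _ (n + 1)]
    exact le_mul_of_one_le_right' (hf1 _ ω)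
  have hgX : ∀ n, ∀ t ∈ F n, ∀ ω, ENNReal.ofReal (Real.exp (l * |X t ω|)) ≤ g n ω := by
    intro n
    induction n with
    | zero =>
      intro t ht ω
      simpa [hg] using hlink 0 t ht ω
    | succ n ih =>
      intro t ht ω
      simp only [hg]
      rw [Finset.prod_range_succ]
      refine le_trans ?_ (mul_le_mul' (ih (π n t) (hπ n t ht) ω) (hlink (n + 1) t ht ω))
      rw [← ENNReal.ofReal_mul (Real.exp_nonneg _), ← Real.exp_add, ← mul_add]
      refine ENNReal.ofReal_le_ofReal (Real.exp_le_exp.2 ?_)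
      gcongr
      have := abs_add_le (X (π n t) ω) (L (n + 1) t ω)
      simpa [hL] using this
  have hgint : ∀ n, ∫⁻ ω, g n ω ∂P ≤ ENNReal.ofReal (2 * Real.exp (c + 2 * l * B)) := by
    intro n
    refine (lintegral_prod_rpow_le _ (fun k _ => hfm k) (fun k _ => (hp0 k).le)
      (hpsum (n + 1))).trans ?_
    calc ∏ k ∈ Finset.range (n + 1), (∫⁻ ω, f k ω ∂P) ^ p k
        ≤ ∏ k ∈ Finset.range (n + 1),
            ENNReal.ofReal (Real.exp ((Real.log 2 + c + 2 * H k) * p k)) := by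
          refine Finset.prod_le_prod' fun k _ => ?_
          rw [Real.exp_mul, ← ENNReal.ofReal_rpow_of_pos (Real.exp_pos _)]
          exact ENNReal.rpow_le_rpow (hfint k) (hp0 k).le
      _ = ENNReal.ofReal (Real.exp (∑ k ∈ Finset.range (n + 1),
            (Real.log 2 + c + 2 * H k) * p k)) := by
          rw [Real.exp_sum, ENNReal.ofReal_prod_of_nonneg fun _ _ => Real.exp_nonneg _]
      _ ≤ _ := by
          refine ENNReal.ofReal_le_ofReal ?_
          rw [← Real.exp_log two_pos, ← Real.exp_add, Real.exp_log two_pos]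
          refine Real.exp_le_exp.2 ?_
          have hlog : 0 ≤ Real.log 2 := Real.log_nonneg one_le_two
          have hterm : ∀ k, H k * p k ≤ l * (ε * θ ^ k * Psi φ (H k)) := by
            intro k
            rcases eq_or_lt_of_le (hH k) with h | h
            · rw [← h]; simp [Psi]
            have hiH := hφ.inv_pos h
            have hii : inv φ (H k) ≤ inv φ (c + H k) := hφ.inv_mono (by linarith)
            calc H k * p k = l * ε * θ ^ k * (H k / inv φ (c + H k)) := by simp only [hp]; ring
              _ ≤ l * ε * θ ^ k * (H k / inv φ (H k)) := by gcongr
              _ = _ := by rw [Psi]; ring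
          calc ∑ k ∈ Finset.range (n + 1), (Real.log 2 + c + 2 * H k) * p k
              = (Real.log 2 + c) * ∑ k ∈ Finset.range (n + 1), p k +
                2 * ∑ k ∈ Finset.range (n + 1), H k * p k := by
                rw [Finset.mul_sum, Finset.mul_sum, ← Finset.sum_add_distrib]
                exact Finset.sum_congr rfl fun k _ => by ring
            _ ≤ (Real.log 2 + c) * 1 +
                2 * ∑ k ∈ Finset.range (n + 1), l * (ε * θ ^ k * Psi φ (H k)) := by
                have hs := Finset.sum_le_sum fun k (_ : k ∈ Finset.range (n + 1)) => hterm k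
                have := hpsum (n + 1)
                gcongr
            _ ≤ Real.log 2 + (c + 2 * l * B) := by
                rw [← Finset.mul_sum]
                nlinarith [hB (n + 1)]
  have hae : ∀ᵐ ω ∂P, ∀ t ∈ D, ENNReal.ofReal (Real.exp (l * |X t ω|)) ≤ ⨆ n, g n ω := by
    rw [ae_ball_iff hD]
    intro t ht
    obtain ⟨ns, -, hns⟩ := (tendstoInMeasure_of_tendsto_eLpNorm two_ne_zero
      (fun n => (hX (α n t)).aestronglyMeasurable) (hX t).aestronglyMeasurable
      (hαt t ht)).exists_seq_tendsto_ae
    filter_upwards [hns] with ω hω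
    refine le_of_tendsto (ENNReal.tendsto_ofReal
      ((Real.continuous_exp.tendsto _).comp (hω.abs.const_mul l)))
      (Eventually.of_forall fun n => ?_)
    exact (hgX (ns n) _ (hα _ t ht) ω).trans (le_iSup (fun n => g n ω) (ns n))
  have hsup : ∫⁻ ω, ⨆ n, g n ω ∂P ≤ ENNReal.ofReal (2 * Real.exp (c + 2 * l * B)) := by
    rw [lintegral_iSup' hgm (Eventually.of_forall hgmono)]
    exact iSup_le hgint
  calc P {ω | ∃ t ∈ D, w < |X t ω|}
      ≤ P {ω | ENNReal.ofReal (Real.exp (l * w)) ≤ ⨆ n, g n ω} := by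
        refine measure_mono_ae ?_
        filter_upwards [hae] with ω hω
        rintro ⟨t, ht, hw⟩
        refine le_trans (ENNReal.ofReal_le_ofReal (Real.exp_le_exp.2 ?_)) (hω t ht)
        gcongr
    _ ≤ (∫⁻ ω, ⨆ n, g n ω ∂P) / ENNReal.ofReal (Real.exp (l * w)) :=
        meas_ge_le_lintegral_div (AEMeasurable.iSup hgm)
          (ENNReal.ofReal_pos.2 (Real.exp_pos _)).ne' ENNReal.ofReal_ne_top
    _ ≤ ENNReal.ofReal (2 * Real.exp (c + 2 * l * B)) / ENNReal.ofReal (Real.exp (l * w)) := by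
        gcongr
    _ = _ := by
        rw [← ENNReal.ofReal_div_of_pos (Real.exp_pos _), mul_div_assoc, ← Real.exp_sub]

/-- Optimizing an exponential bound over `l` produces the conjugate function. -/
lemma le_ofReal_exp_neg_conj {M : ℝ≥0∞} (hM : M ≤ 1) {m x : ℝ} (hφ : IsNFunction φ)
    (hx : 0 ≤ x) (hm : 1 ≤ m)
    (h : ∀ l, 0 < l → M ≤ ENNReal.ofReal (m * Real.exp (φ l - l * x))) :
    M ≤ ENNReal.ofReal (m * Real.exp (-conj φ x)) := by
  have hMtop : M ≠ ⊤ := ne_top_of_le_ne_top ENNReal.one_ne_top hM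
  rcases eq_or_ne M 0 with rfl | hM0
  · exact zero_le
  have hpos : 0 < M.toReal := ENNReal.toReal_pos hM0 hMtop
  have hm0 : 0 < m := by linarith
  have key : conj φ x ≤ -Real.log (M.toReal / m) := by
    refine ciSup_le fun l => ?_
    rcases le_or_gt l 0 with hl | hl
    · have h1 : M.toReal / m ≤ 1 := by
        rw [div_le_one hm0]
        have := ENNReal.toReal_mono ENNReal.one_ne_top hM
        rw [ENNReal.toReal_one] at this
        linarith
      have := Real.log_nonpos (by positivity) h1
      nlinarith [hφ.nonneg l]
    · have h1 := ENNReal.toReal_le_of_le_ofReal (by positivity) (h l hl)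
      have h2 : M.toReal / m ≤ Real.exp (φ l - l * x) := by
        rw [div_le_iff₀ hm0]; linarith
      have h3 := Real.log_le_log (by positivity) h2
      rw [Real.log_exp] at h3
      linarith
  rw [← ENNReal.ofReal_toReal hMtop]
  refine ENNReal.ofReal_le_ofReal ?_
  have h1 : M.toReal / m ≤ Real.exp (-conj φ x) := by
    rw [← Real.exp_log (by positivity : 0 < M.toReal / m)]
    exact Real.exp_le_exp.2 (by linarith)
  rw [div_le_iff₀ hm0] at h1
  linarith

end Chaining

section ChainingTail

variable {Ω : Type*} [MeasurableSpace Ω] {P : Measure Ω} [IsProbabilityMeasure P] {φ : ℝ → ℝ}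

/-- Tail bound for the supremum of a continuous process whose increments are controlled by their
mean-square norms, in terms of finite mean-square nets of mesh `ε θ^(k+1)`. -/
lemma measure_exists_lt_abs_le_of_nets {ι : Type*} [TopologicalSpace ι]
    [TopologicalSpace.SeparableSpace ι] (hφ : IsNFunction φ) {X : ι → Ω → ℝ}
    (hX : ∀ t, MemLp (X t) 2 P) {C θ ε : ℝ} (hC : 0 < C) (hθ0 : 0 < θ) (hθ1 : θ < 1) (hε : 0 < ε)
    (h0 : ∀ t, SubExp P φ (X t) ε)
    (h1 : ∀ t t', SubExp P φ (fun ω => X t ω - X t' ω)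
      (C * (eLpNorm (fun ω => X t ω - X t' ω) 2 P).toReal))
    {H : ℕ → ℝ} (hH : ∀ k, 0 ≤ H k)
    (hnet : ∀ k, ∃ F : Finset ι, F.Nonempty ∧ (F.card : ℝ) ≤ Real.exp (H k) ∧
      ∀ t, ∃ t' ∈ F, C * (eLpNorm (fun ω => X t ω - X t' ω) 2 P).toReal ≤ ε * θ ^ (k + 1))
    {B : ℝ} (hB : ∀ n, ∑ k ∈ Finset.range n, ε * θ ^ k * Psi φ (H k) ≤ B)
    (hcont : ∀ᵐ ω ∂P, Continuous fun t => X t ω) {w : ℝ} (hw : 2 * B ≤ w) :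
    P {ω | ∃ t, w < |X t ω|} ≤
      ENNReal.ofReal (2 * Real.exp (-conj φ ((1 - θ) * (w - 2 * B) / ε))) := by
  have hθ' : 0 < 1 - θ := sub_pos.2 hθ1
  choose F hFne hFc α hα hαe using hnet
  obtain ⟨D, hD, hDd⟩ := TopologicalSpace.exists_countable_dense ι
  have hDle : P {ω | ∃ t, w < |X t ω|} ≤ P {ω | ∃ t ∈ D, w < |X t ω|} := by
    refine measure_mono_ae ?_
    filter_upwards [hcont] with ω hω
    rintro ⟨t, ht⟩
    obtain ⟨t', ht', htD⟩ := hDd.inter_open_nonempty _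
      (isOpen_lt continuous_const hω.abs) ⟨t, ht⟩
    exact ⟨t', htD, ht'⟩
  refine hDle.trans (le_ofReal_exp_neg_conj prob_le_one hφ ?_ one_le_two fun l hl => ?_)
  · exact div_nonneg (mul_nonneg hθ'.le (by linarith)) hε.le
  have hlim : ∀ t, Tendsto (fun n => eLpNorm (X (α n t) - X t) 2 P) atTop (𝓝 0) := by
    intro t
    have hz : Tendsto (fun n : ℕ => ENNReal.ofReal (ε * θ ^ (n + 1) / C)) atTop (𝓝 0) := by
      rw [← ENNReal.ofReal_zero]
      refine ENNReal.tendsto_ofReal ?_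
      have := (tendsto_pow_atTop_nhds_zero_of_lt_one hθ0.le hθ1).comp (tendsto_add_atTop_nat 1)
      simpa using (this.const_mul ε).div_const C
    refine tendsto_of_tendsto_of_tendsto_of_le_of_le tendsto_const_nhds hz
      (fun _ => zero_le) fun n => ?_
    rw [eLpNorm_sub_comm,
      ← ENNReal.ofReal_toReal ((hX t).sub (hX (α n t))).eLpNorm_ne_top]
    refine ENNReal.ofReal_le_ofReal ?_
    rw [le_div_iff₀ hC, mul_comm]
    exact hαe n t
  have key := measure_exists_lt_abs_le hφ (fun t => (hX t).aestronglyMeasurable.aemeasurable)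
    hθ0 hθ1 hε (l := l * (1 - θ) / ε) (by positivity) hFne hH hFc (π := α)
    (fun k t _ => hα k t) (fun t _ => h0 t)
    (fun k t _ => (h1 t (α k t)).mono hφ (mul_nonneg hC.le ENNReal.toReal_nonneg) (hαe k t))
    hB hD (fun n t _ => hα n t) (fun t _ => hlim t) w
  refine key.trans_eq ?_
  congr 3
  have : l * (1 - θ) / ε * ε / (1 - θ) = l := by field_simp
  rw [this]
  ring

end ChainingTail

/-! ### Entropy integrals and nets of rectangles -/

/-- Comparison of a geometric sum with the integral of a non-increasing function. -/
lemma sum_mul_pow_le_integral {E : ℝ → ℝ} {θ ε : ℝ} (hθ0 : 0 < θ) (hθ1 : θ < 1) (hε : 0 < ε)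
    (hE : AntitoneOn E (Ioc 0 (θ * ε))) (hE0 : ∀ s ∈ Ioc 0 (θ * ε), 0 ≤ E s)
    (hEi : IntervalIntegrable E volume 0 (θ * ε)) (n : ℕ) :
    ∑ k ∈ Finset.range n, ε * θ ^ k * E (ε * θ ^ (k + 1)) ≤
      (∫ s in (0 : ℝ)..(θ * ε), E s) * (1 / (θ * (1 - θ))) := by
  have hθ' : 0 < 1 - θ := sub_pos.2 hθ1
  have hθε : 0 < θ * ε := mul_pos hθ0 hε
  have hmem : ∀ k : ℕ, ε * θ ^ (k + 1) ∈ Ioc 0 (θ * ε) := by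
    intro k
    refine ⟨by positivity, ?_⟩
    have := pow_le_one₀ hθ0.le hθ1.le (n := k)
    rw [pow_succ]
    nlinarith
  have hsub : ∀ a ∈ Icc 0 (θ * ε), ∀ b ∈ Icc 0 (θ * ε), IntervalIntegrable E volume a b :=
    fun a ha b hb => hEi.mono_set (uIcc_subset_uIcc (by rwa [uIcc_of_le hθε.le])
      (by rwa [uIcc_of_le hθε.le]))
  have hmem' := fun k => Ioc_subset_Icc_self (hmem k)
  have key : ∀ n : ℕ, θ * (1 - θ) * ∑ k ∈ Finset.range n, ε * θ ^ k * E (ε * θ ^ (k + 1)) ≤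
      ∫ s in (ε * θ ^ (n + 1))..(θ * ε), E s := by
    intro n
    induction n with
    | zero => simp [mul_comm]
    | succ n ih =>
      rw [Finset.sum_range_succ, mul_add, add_comm,
        ← intervalIntegral.integral_add_adjacent_intervals (hsub _ (hmem' (n + 1)) _ (hmem' n))
          (hsub _ (hmem' n) _ (right_mem_Icc.2 hθε.le))]
      refine add_le_add ?_ ih
      have hle : ε * θ ^ (n + 1 + 1) ≤ ε * θ ^ (n + 1) := by
        rw [pow_succ θ (n + 1)]
        have : 0 < ε * θ ^ (n + 1) := by positivity
        nlinarith
      have := intervalIntegral.integral_mono_on hle (intervalIntegrable_const (μ := volume)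
        (c := E (ε * θ ^ (n + 1)))) (hsub _ (hmem' (n + 1)) _ (hmem' n))
        fun s hs => hE ⟨(hmem (n + 1)).1.trans_le hs.1, hs.2.trans (hmem n).2⟩ (hmem n) hs.2
      rw [intervalIntegral.integral_const, smul_eq_mul] at this
      refine le_trans (le_of_eq ?_) this
      ring
  have hlast : ∫ s in (ε * θ ^ (n + 1))..(θ * ε), E s ≤ ∫ s in (0 : ℝ)..(θ * ε), E s := by
    rw [← intervalIntegral.integral_add_adjacent_intervals
      (hsub _ (left_mem_Icc.2 hθε.le) _ (hmem' n)) (hsub _ (hmem' n) _ (right_mem_Icc.2 hθε.le))]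
    have : 0 ≤ ∫ s in (0 : ℝ)..(ε * θ ^ (n + 1)), E s := by
      rw [intervalIntegral.integral_of_le (hmem n).1.le]
      exact setIntegral_nonneg measurableSet_Ioc fun s hs =>
        hE0 s ⟨hs.1, hs.2.trans (hmem n).2⟩
    linarith
  rw [mul_one_div, le_div_iff₀ (by positivity)]
  linarith [key n]

section Entropy

variable {φ Z : ℝ → ℝ} {u₀ A L K δ : ℝ}

/-- The logarithm of the size of the net of mesh `s` in a rectangle of sides `2 A` and `L`. It is
meaningful for `Z u₀ ≤ K / s`; outside this range the logarithms are junk values. -/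
noncomputable def entropy (Z : ℝ → ℝ) (u₀ A L K s : ℝ) : ℝ :=
  Real.log (A * (inv Z (K / s) - u₀) + 1) + Real.log (L / 2 * (inv Z (K / s) - u₀) + 1)

lemma IsAdmissible.le_inv (hZ : IsAdmissible φ Z u₀) {v x : ℝ} (hx : 0 ≤ x) (h : Z x ≤ v) :
    x ≤ inv Z v := by
  rw [← inv_apply hZ.strictMonoOn hx]
  exact inv_mono hZ.tendsto_top h

lemma entropy_nonneg (hA : 0 ≤ A) (hL : 0 ≤ L) {s : ℝ} (hs : u₀ ≤ inv Z (K / s)) :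
    0 ≤ entropy Z u₀ A L K s := by
  have h := sub_nonneg.2 hs
  refine add_nonneg (Real.log_nonneg ?_) (Real.log_nonneg ?_) <;>
    linarith [mul_nonneg hA h, mul_nonneg (div_nonneg hL zero_le_two) h]

lemma IsAdmissible.le_inv_div (hZ : IsAdmissible φ Z u₀) (hK : 0 < K) (hKδ : Z u₀ ≤ K / δ) {s : ℝ}
    (hs : s ∈ Ioc 0 δ) : u₀ ≤ inv Z (K / s) :=
  hZ.le_inv hZ.nonneg (hKδ.trans (div_le_div_of_nonneg_left hK.le hs.1 hs.2))

lemma antitoneOn_Psi_entropy (hφ : IsNFunction φ) (hZ : IsAdmissible φ Z u₀) (hA : 0 ≤ A)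
    (hL : 0 ≤ L) (hK : 0 < K) (hKδ : Z u₀ ≤ K / δ) :
    AntitoneOn (fun s => Psi φ (entropy Z u₀ A L K s)) (Ioc 0 δ) := by
  intro s hs t ht hst
  have hs' := hZ.le_inv_div hK hKδ hs
  have ht' := hZ.le_inv_div hK hKδ ht
  refine hφ.Psi_monotoneOn (entropy_nonneg hA hL ht') (entropy_nonneg hA hL hs') ?_
  have hle : inv Z (K / t) ≤ inv Z (K / s) :=
    inv_mono hZ.tendsto_top (div_le_div_of_nonneg_left hK.le hs.1 hst)
  have h := sub_nonneg.2 ht'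
  have hL2 : 0 ≤ L / 2 := div_nonneg hL zero_le_two
  unfold entropy
  refine add_le_add (Real.log_le_log (by linarith [mul_nonneg hA h]) ?_)
    (Real.log_le_log (by linarith [mul_nonneg hL2 h]) ?_) <;> gcongr

/-- Near `0` the entropy is at most a multiple of the logarithm in the admissibility condition,
which makes the entropy integral converge. -/
lemma log_add_log_le (hA : 0 ≤ A) (hL : 0 ≤ L) {x : ℝ} (hx : 2 ≤ x) :
    Real.log (A * x + 1) + Real.log (L / 2 * x + 1) ≤
      (2 + (Real.log (A + 1) + Real.log (L / 2 + 1)) / Real.log 2) * Real.log x := by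
  have h2 : 0 < Real.log 2 := Real.log_pos one_lt_two
  have hlx : Real.log 2 ≤ Real.log x := Real.log_le_log two_pos hx
  have hx0 : 0 < x := by linarith
  have key : ∀ a, 0 ≤ a → 0 ≤ Real.log (a + 1) ∧
      Real.log (a * x + 1) ≤ Real.log (a + 1) + Real.log x := by
    intro a ha
    refine ⟨Real.log_nonneg (by linarith), ?_⟩
    rw [← Real.log_mul (by linarith) hx0.ne']
    exact Real.log_le_log (by positivity) (by linarith)
  obtain ⟨p1, q1⟩ := key A hA
  obtain ⟨p2, q2⟩ := key (L / 2) (by positivity)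
  have h3 : Real.log (A + 1) + Real.log (L / 2 + 1) ≤
      (Real.log (A + 1) + Real.log (L / 2 + 1)) / Real.log 2 * Real.log x := by
    rw [div_mul_eq_mul_div, le_div_iff₀ h2]
    gcongr
  linarith

lemma intervalIntegrable_Psi_entropy (hφ : IsNFunction φ) (hZ : IsAdmissible φ Z u₀) (hA : 0 ≤ A)
    (hL : 0 ≤ L) (hK : 0 < K) (hδ : 0 < δ) (hKδ : Z u₀ ≤ K / δ) :
    IntervalIntegrable (fun s => Psi φ (entropy Z u₀ A L K s)) volume 0 δ := by
  have hanti := antitoneOn_Psi_entropy hφ hZ hA hL hK hKδ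
  obtain ⟨ε, hε, hint⟩ := hZ.integrable
  have hu := hZ.nonneg
  have hZ2 : 0 < Z (u₀ + 2) := hZ.pos _ (by linarith)
  -- on `(0, η]` the integrand is dominated through admissibility, on `[η, δ]` it is monotone
  obtain ⟨η, hη0, hη⟩ : ∃ η, 0 < η ∧ η ≤ min δ (min (K * ε) (K / Z (u₀ + 2))) :=
    ⟨_, lt_min hδ (lt_min (by positivity) (by positivity)), le_rfl⟩
  have hηδ : η ≤ δ := hη.trans (min_le_left _ _)
  have hηε : η ≤ K * ε := hη.trans ((min_le_right _ _).trans (min_le_left _ _))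
  have hηZ : η ≤ K / Z (u₀ + 2) := hη.trans ((min_le_right _ _).trans (min_le_right _ _))
  refine IntervalIntegrable.trans (b := η) ?_ ?_
  · have h1 : IntervalIntegrable (fun s => Psi φ (Real.log (inv Z (1 / s) - u₀))) volume 0 ε :=
      (intervalIntegrable_iff_integrableOn_Ioo_of_le hε.le).2 hint
    have h2 := h1.comp_mul_left (c := K⁻¹)
    rw [zero_div, div_inv_eq_mul, mul_comm ε K] at h2
    have h3 : IntervalIntegrable (fun s => Psi φ (Real.log (inv Z (1 / (K⁻¹ * s)) - u₀)))
        volume 0 η := h2.mono_set (by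
      rw [uIcc_of_le hη0.le, uIcc_of_le (by positivity)]
      exact Icc_subset_Icc_right hηε)
    set M := 2 + (Real.log (A + 1) + Real.log (L / 2 + 1)) / Real.log 2 with hM
    have hM1 : 1 ≤ M := by
      have : 0 ≤ (Real.log (A + 1) + Real.log (L / 2 + 1)) / Real.log 2 :=
        div_nonneg (add_nonneg (Real.log_nonneg (by linarith)) (Real.log_nonneg (by linarith)))
          (Real.log_nonneg one_le_two)
      linarith
    refine (h3.const_mul M).mono_fun' ?_ ?_
    · rw [uIoc_of_le hη0.le]
      exact (aemeasurable_restrict_of_antitoneOn measurableSet_Ioc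
        (hanti.mono (Ioc_subset_Ioc_right hηδ))).aestronglyMeasurable
    · rw [uIoc_of_le hη0.le]
      refine (ae_restrict_iff' measurableSet_Ioc).2 (Eventually.of_forall fun s hs => ?_)
      have hs' := hZ.le_inv_div hK hKδ (Ioc_subset_Ioc_right hηδ hs)
      have hx : 2 ≤ inv Z (K / s) - u₀ := by
        have : Z (u₀ + 2) ≤ K / s := by
          rw [le_div_iff₀ hs.1]
          have := hs.2.trans hηZ
          rwa [le_div_iff₀ hZ2, mul_comm] at this
        have := hZ.le_inv (by linarith) this
        linarith
      beta_reduce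
      rw [show 1 / (K⁻¹ * s) = K / s by field_simp, Real.norm_of_nonneg
        (IsNFunction.Psi_nonneg (entropy_nonneg hA hL hs'))]
      have hlog : 0 ≤ Real.log (inv Z (K / s) - u₀) := Real.log_nonneg (by linarith)
      exact (hφ.Psi_monotoneOn (entropy_nonneg hA hL hs') (mul_nonneg (by linarith) hlog)
        (log_add_log_le hA hL hx)).trans (hφ.Psi_mul_le hM1 hlog)
  · refine AntitoneOn.intervalIntegrable (hanti.mono ?_)
    rw [uIcc_of_le hηδ]
    exact fun s hs => ⟨hη0.trans_le hs.1, hs.2⟩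

end Entropy

/-- An interval of length `d - c` has an `r`-net with at most `(d - c) / (2 r) + 1` points, the
midpoints of equal subintervals. -/
lemma exists_net_Icc {c d r : ℝ} (hcd : c < d) (hr : 0 < r) :
    ∃ F : Finset ℝ, (F.card : ℝ) ≤ (d - c) / (2 * r) + 1 ∧ (∀ f ∈ F, f ∈ Icc c d) ∧
      ∀ x ∈ Icc c d, ∃ f ∈ F, |x - f| ≤ r := by
  have hdc : 0 < d - c := sub_pos.2 hcd
  set n := ⌈(d - c) / (2 * r)⌉₊ with hn
  have hn0 : 0 < n := Nat.ceil_pos.2 (by positivity)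
  have hnR : (0 : ℝ) < n := Nat.cast_pos.2 hn0
  set w := (d - c) / n with hw
  have hw0 : 0 < w := by positivity
  have hwn : w * n = d - c := by rw [hw]; field_simp
  have hwr : w ≤ 2 * r := by
    have h := Nat.le_ceil ((d - c) / (2 * r))
    rw [← hn, div_le_iff₀ (by positivity)] at h
    rw [hw, div_le_iff₀ hnR]
    linarith
  refine ⟨(Finset.range n).image fun i : ℕ => c + (i + 1 / 2) * w, ?_, ?_, ?_⟩
  · have h1 : (((Finset.range n).image fun i : ℕ => c + ((i : ℝ) + 1 / 2) * w).card : ℝ) ≤ n := by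
      exact_mod_cast Finset.card_image_le.trans_eq (Finset.card_range n)
    exact h1.trans (Nat.ceil_lt_add_one (by positivity)).le
  · intro f hf
    obtain ⟨i, hi, rfl⟩ := Finset.mem_image.1 hf
    have hi' : (i : ℝ) + 1 ≤ n := by exact_mod_cast Finset.mem_range.1 hi
    have h0 : (0 : ℝ) ≤ i := Nat.cast_nonneg i
    constructor <;> nlinarith
  · intro x hx
    have hz0 : 0 ≤ (x - c) / w := div_nonneg (sub_nonneg.2 hx.1) hw0.le
    have hzn : (x - c) / w ≤ n := by
      rw [div_le_iff₀ hw0, mul_comm, hwn]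
      linarith [hx.2]
    obtain ⟨i, hi, h1, h2⟩ : ∃ i < n, (i : ℝ) ≤ (x - c) / w ∧ (x - c) / w ≤ i + 1 := by
      rcases lt_or_ge ⌊(x - c) / w⌋₊ n with h | h
      · exact ⟨_, h, Nat.floor_le hz0, (Nat.lt_floor_add_one _).le⟩
      · have hge : (n : ℝ) ≤ (x - c) / w := (Nat.le_floor_iff hz0).1 h
        have hcast : ((n - 1 : ℕ) : ℝ) = n - 1 := by
          rw [Nat.cast_sub (by omega : 1 ≤ n), Nat.cast_one]
        exact ⟨n - 1, by omega, by rw [hcast]; linarith, by rw [hcast]; linarith⟩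
    refine ⟨_, Finset.mem_image_of_mem _ (Finset.mem_range.2 hi), ?_⟩
    rw [le_div_iff₀ hw0] at h1
    rw [div_le_iff₀ hw0] at h2
    rw [abs_le]
    constructor <;> linarith

lemma exists_net_rectangle {A b b' r : ℝ} (hA : 0 < A) (hb : b < b') (hr : 0 < r) :
    ∃ F : Finset (ℝ × ℝ), (F.card : ℝ) ≤ (A / r + 1) * ((b' - b) / (2 * r) + 1) ∧
      (∀ f ∈ F, f ∈ Icc (-A) A ×ˢ Icc b b') ∧
      ∀ q ∈ Icc (-A) A ×ˢ Icc b b', ∃ f ∈ F, |q.1 - f.1| ≤ r ∧ |q.2 - f.2| ≤ r := by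
  obtain ⟨F₁, hc₁, hm₁, hn₁⟩ := exists_net_Icc (by linarith : -A < A) hr
  obtain ⟨F₂, hc₂, hm₂, hn₂⟩ := exists_net_Icc hb hr
  refine ⟨F₁ ×ˢ F₂, ?_, ?_, ?_⟩
  · rw [Finset.card_product, Nat.cast_mul]
    have : (A - -A) / (2 * r) = A / r := by field_simp; ring
    rw [this] at hc₁
    gcongr
  · intro f hf
    rw [Finset.mem_product] at hf
    exact ⟨hm₁ _ hf.1, hm₂ _ hf.2⟩
  · intro q hq
    obtain ⟨f₁, hf₁, h₁⟩ := hn₁ q.1 hq.1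
    obtain ⟨f₂, hf₂, h₂⟩ := hn₂ q.2 hq.2
    exact ⟨(f₁, f₂), Finset.mk_mem_product hf₁ hf₂, h₁, h₂⟩

/-! ### The supremum over one block and over the half-strip -/

section Blocks

variable {Ω : Type*} [MeasurableSpace Ω] {P : Measure Ω} {φ Z : ℝ → ℝ}
  {u₀ : ℝ} {y : ℝ → Ω → ℝ} {N : ℕ} {a : ℕ → ℝ} {κ : ℝ → ℝ} {Cy A b b' ε θ : ℝ}

/-- A continuous process all of whose values obey the exponential bound with constant `0`
vanishes: Markov's inequality gives `P(|X t| > w) ≤ 2 exp(-l w)` for every `l > 0`. -/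
lemma measure_exists_lt_abs_eq_zero {ι : Type*} [TopologicalSpace ι]
    [TopologicalSpace.SeparableSpace ι] (hφ : IsNFunction φ) {X : ι → Ω → ℝ}
    (hX : ∀ t, AEMeasurable (X t) P) (h0 : ∀ t, SubExp P φ (X t) 0)
    (hcont : ∀ᵐ ω ∂P, Continuous fun t => X t ω) {w : ℝ} (hw : 0 < w) :
    P {ω | ∃ t, w < |X t ω|} = 0 := by
  obtain ⟨D, hD, hDd⟩ := TopologicalSpace.exists_countable_dense ι
  have hpt : ∀ t, P {ω | w < |X t ω|} = 0 := by
    intro t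
    have hb : ∀ l : ℝ, 0 < l → P {ω | w < |X t ω|} ≤ ENNReal.ofReal (2 * Real.exp (-(l * w))) := by
      intro l hl
      have hint := SubExp.lintegral_sum_exp_le (F := {t}) (D := X) (μ := l) (H := 0)
        (fun t _ => hX t) (by simp) (fun t _ => h0 t) hφ
      simp only [Finset.sum_singleton, zero_mul, hφ.map_zero, add_zero,
        Real.exp_log two_pos] at hint
      have hm : ∀ l : ℝ, AEMeasurable (fun ω => ENNReal.ofReal (Real.exp (l * X t ω))) P :=
        fun l => (Real.measurable_exp.comp_aemeasurable ((hX t).const_mul l)).ennreal_ofReal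
      calc P {ω | w < |X t ω|}
          ≤ P {ω | ENNReal.ofReal (Real.exp (l * w)) ≤ ENNReal.ofReal (Real.exp (l * X t ω)) +
              ENNReal.ofReal (Real.exp (-l * X t ω))} := by
            refine measure_mono fun ω hω => ?_
            have h1 : ENNReal.ofReal (Real.exp (l * w)) ≤
                ENNReal.ofReal (Real.exp (l * |X t ω|)) := by
              refine ENNReal.ofReal_le_ofReal (Real.exp_le_exp.2 ?_)
              exact mul_le_mul_of_nonneg_left (le_of_lt hω) hl.le
            refine h1.trans ?_
            rcases abs_choice (X t ω) with h | h <;> rw [h]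
            · exact le_self_add
            · rw [mul_neg, ← neg_mul]
              exact le_add_self
        _ ≤ (∫⁻ ω, (ENNReal.ofReal (Real.exp (l * X t ω)) +
              ENNReal.ofReal (Real.exp (-l * X t ω))) ∂P) / ENNReal.ofReal (Real.exp (l * w)) :=
            meas_ge_le_lintegral_div ((hm l).add (hm (-l)))
              (ENNReal.ofReal_pos.2 (Real.exp_pos _)).ne' ENNReal.ofReal_ne_top
        _ ≤ ENNReal.ofReal 2 / ENNReal.ofReal (Real.exp (l * w)) := by gcongr
        _ = _ := by
            rw [← ENNReal.ofReal_div_of_pos (Real.exp_pos _), Real.exp_neg, div_eq_mul_inv]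
    have hlim : Tendsto (fun l : ℝ => ENNReal.ofReal (2 * Real.exp (-(l * w)))) atTop (𝓝 0) := by
      rw [← ENNReal.ofReal_zero]
      refine ENNReal.tendsto_ofReal ?_
      have := (Real.tendsto_exp_neg_atTop_nhds_zero.comp
        (tendsto_id.atTop_mul_const hw)).const_mul 2
      simpa using this
    refine le_antisymm (ge_of_tendsto hlim ?_) zero_le
    filter_upwards [eventually_gt_atTop 0] with l hl using hb l hl
  refine le_antisymm (le_trans (measure_mono_ae (t := ⋃ t ∈ D, {ω | w < |X t ω|}) ?_)
    (measure_biUnion_null_iff hD |>.2 fun t _ => hpt t).le) zero_le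
  filter_upwards [hcont] with ω hω
  rintro ⟨t, ht⟩
  obtain ⟨t', ht', htD⟩ := hDd.inter_open_nonempty _
    (isOpen_lt continuous_const hω.abs) ⟨t, ht⟩
  exact mem_biUnion htD ht'

/-- The mean-square distance of any point of a rectangle from its corner. -/
lemma eLpNorm_sub_corner_le (hZ : IsAdmissible φ Z u₀) (hy : ∀ t, MemLp (y t) 2 P)
    (hκ : κ = Real.cos ∨ κ = Real.sin) (hCZ : CZsq P y Z u₀ N a ≠ ⊤) (hA : 0 < A) (hb : b < b')
    {U : ℝ → ℝ → Ω → ℝ}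
    (hU : ∀ q ∈ Icc (-A) A ×ˢ Icc b b', HasMSIntegral P y (kernelI κ N a q.2 q.1) (U q.2 q.1))
    {q : ℝ × ℝ} (hq : q ∈ Icc (-A) A ×ˢ Icc b b') :
    eLpNorm (fun ω => U q.2 q.1 ω - U b (-A) ω) 2 P ≤
      ENNReal.ofReal (2 / Z (1 / (2 * A + (b' - b)) + u₀) * CZ P y Z u₀ N a) := by
  have hU₀ : HasMSIntegral P y (kernelI κ N a b (-A)) (U b (-A)) :=
    hU (-A, b) ⟨⟨le_rfl, by linarith⟩, ⟨le_rfl, hb.le⟩⟩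
  have hUq := hU q hq
  obtain ⟨x, t⟩ := q
  obtain ⟨⟨h1, h2⟩, ⟨h3, h4⟩⟩ := hq
  dsimp only at h1 h2 h3 h4 hUq ⊢
  refine eLpNorm_sub_le_of_abs_le hZ hy hκ hCZ (by linarith) ?_ ?_ hUq hU₀
  · rw [abs_le]
    constructor <;> linarith
  · rw [abs_le]
    constructor <;> linarith

/-- The mean-square norms of the field are bounded on a rectangle. -/
lemma bddAbove_sqrt_field (hZ : IsAdmissible φ Z u₀) (hy : ∀ t, MemLp (y t) 2 P)
    (hκ : κ = Real.cos ∨ κ = Real.sin) (hCZ : CZsq P y Z u₀ N a ≠ ⊤) (hA : 0 < A) (hb : b < b')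
    {U : ℝ → ℝ → Ω → ℝ}
    (hU : ∀ q ∈ Icc (-A) A ×ˢ Icc b b', HasMSIntegral P y (kernelI κ N a q.2 q.1) (U q.2 q.1)) :
    BddAbove ((fun q : ℝ × ℝ => Real.sqrt (∫ ω, |U q.2 q.1 ω| ^ 2 ∂P)) ''
      (Icc (-A) A ×ˢ Icc b b')) := by
  have hU₀ : MemLp (U b (-A)) 2 P :=
    (hU (-A, b) ⟨⟨le_rfl, by linarith⟩, ⟨le_rfl, hb.le⟩⟩).1
  set R := 2 / Z (1 / (2 * A + (b' - b)) + u₀) * CZ P y Z u₀ N a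
  refine ⟨(ENNReal.ofReal R + eLpNorm (U b (-A)) 2 P).toReal, ?_⟩
  rintro _ ⟨q, hq, rfl⟩
  have h := eLpNorm_sub_corner_le hZ hy hκ hCZ hA hb hU hq
  have h2 : eLpNorm (U q.2 q.1) 2 P ≤ ENNReal.ofReal R + eLpNorm (U b (-A)) 2 P := by
    have hs := eLpNorm_add_le ((hU q hq).1.sub hU₀).aestronglyMeasurable
      hU₀.aestronglyMeasurable (p := 2) one_le_two
    rw [sub_add_cancel] at hs
    exact hs.trans (add_le_add_left h _)
  have h3 := ENNReal.toReal_mono (by simp [hU₀.eLpNorm_ne_top]) h2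
  rw [eLpNorm_two_eq_sqrt (hU q hq).1, ENNReal.toReal_ofReal (Real.sqrt_nonneg _)] at h3
  simpa [sq_abs] using h3

/-- Nets of a block for the mean-square distance: at mesh `s` in the mean-square distance they are
nets of mesh `1 / (Z⁽⁻¹⁾(K / s) - u₀)` in the plane, which yields the logarithmic size under the
entropy integral. The hypothesis on `ε` ensures `Z u₀ < K / (θ ε)`, so that `Z⁽⁻¹⁾(K / s) - u₀` is
positive on the whole range of integration. -/
lemma exists_nets (hφ : IsNFunction φ) (hZ : IsAdmissible φ Z u₀) (hy : ∀ t, MemLp (y t) 2 P)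
    (hκ : κ = Real.cos ∨ κ = Real.sin) (hCZ : CZsq P y Z u₀ N a ≠ ⊤) (hA : 0 < A) (hb : b < b')
    {U : ℝ → ℝ → Ω → ℝ}
    (hU : ∀ q ∈ Icc (-A) A ×ˢ Icc b b', HasMSIntegral P y (kernelI κ N a q.2 q.1) (U q.2 q.1))
    (hCy : 0 < Cy) (hε : 0 < ε) (hθ0 : 0 < θ) (hθ1 : θ < 1)
    (hεZ : 0 < Z u₀ → ε ≤ Cy * (1 / (2 * Z u₀) * CZ P y Z u₀ N a)) :
    ∃ H : ℕ → ℝ, (∀ k, 0 ≤ H k) ∧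
      (∀ k, ∃ F : Finset (Icc (-A) A ×ˢ Icc b b' : Set (ℝ × ℝ)), F.Nonempty ∧
        (F.card : ℝ) ≤ Real.exp (H k) ∧ ∀ t : (Icc (-A) A ×ˢ Icc b b' : Set (ℝ × ℝ)), ∃ t' ∈ F,
          Cy * (eLpNorm (fun ω => U t.1.2 t.1.1 ω - U t'.1.2 t'.1.1 ω) 2 P).toReal ≤
            ε * θ ^ (k + 1)) ∧
      ∀ n, ∑ k ∈ Finset.range n, ε * θ ^ k * Psi φ (H k) ≤
        entropyInt φ Z u₀ A (b' - b) (2 * CZ P y Z u₀ N a * Cy) (θ * ε) *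
          (1 / (θ * (1 - θ))) := by
  set R : Set (ℝ × ℝ) := Icc (-A) A ×ˢ Icc b b' with hR
  set c := CZ P y Z u₀ N a with hc
  have hc0 : 0 ≤ c := Real.sqrt_nonneg _
  have hq₀ : ((-A, b) : ℝ × ℝ) ∈ R := ⟨⟨le_rfl, by linarith⟩, ⟨le_rfl, hb.le⟩⟩
  have hL : 0 < b' - b := sub_pos.2 hb
  have hu := hZ.nonneg
  rcases eq_or_lt_of_le hc0 with hc' | hcpos
  · -- for `C_Z = 0` the field is constant in mean square, and one point is a net
    have hZu : Z u₀ = 0 := by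
      by_contra h
      have := hεZ (lt_of_le_of_ne (hZ.map_nonneg hu) (Ne.symm h))
      rw [← hc'] at this
      linarith
    have hu0 : u₀ = 0 := by
      by_contra h
      exact (hZ.pos u₀ (lt_of_le_of_ne hu (Ne.symm h))).ne' hZu
    subst hu0
    have hi : inv Z 0 = 0 := by
      have := inv_apply hZ.strictMonoOn (le_refl (0 : ℝ))
      rwa [hZu] at this
    refine ⟨fun _ => 0, fun _ => le_rfl, fun k => ⟨{⟨_, hq₀⟩}, by simp, by simp, fun t =>
      ⟨_, Finset.mem_singleton_self _, ?_⟩⟩, fun n => ?_⟩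
    · have h := eLpNorm_sub_corner_le hZ hy hκ hCZ hA hb hU t.2
      rw [← hc, ← hc', mul_zero, ENNReal.ofReal_zero, nonpos_iff_eq_zero] at h
      change Cy * (eLpNorm (fun ω => U t.1.2 t.1.1 ω - U b (-A) ω) 2 P).toReal ≤ _
      rw [h]
      simp only [ENNReal.toReal_zero, mul_zero]
      positivity
    · simp [← hc', entropyInt, hi, Psi]
  · have hK : 0 < 2 * c * Cy := by positivity
    have hKδ : Z u₀ < 2 * c * Cy / (θ * ε) := by
      rcases eq_or_lt_of_le (hZ.map_nonneg hu) with h | h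
      · rw [← h]; positivity
      · have h1 := hεZ h
        rw [lt_div_iff₀ (by positivity)]
        have h2 : ε * (2 * Z u₀) ≤ Cy * c := by
          calc ε * (2 * Z u₀) ≤ Cy * (1 / (2 * Z u₀) * c) * (2 * Z u₀) := by gcongr
            _ = _ := by field_simp
        have h3 : θ * (Z u₀ * ε) < 1 * (Z u₀ * ε) := by gcongr
        nlinarith [mul_pos hCy hcpos]
    set s : ℕ → ℝ := fun k => ε * θ ^ (k + 1) with hs
    have hs0 : ∀ k, 0 < s k := fun k => by simp only [hs]; positivity
    have hsle : ∀ k, s k ≤ θ * ε := by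
      intro k
      have := pow_le_one₀ hθ0.le hθ1.le (n := k)
      simp only [hs]
      rw [pow_succ]
      nlinarith [mul_pos hε hθ0]
    have hlt : ∀ k, Z u₀ < 2 * c * Cy / s k := fun k =>
      hKδ.trans_le (div_le_div_of_nonneg_left hK.le (hs0 k) (hsle k))
    have hx : ∀ k, 0 < inv Z (2 * c * Cy / s k) - u₀ := fun k => sub_pos.2
      (lt_inv_of_lt hZ.continuousOn hZ.strictMonoOn hZ.tendsto_top hu (hlt k))
    refine ⟨fun k => entropy Z u₀ A (b' - b) (2 * c * Cy) (s k),
      fun k => entropy_nonneg hA.le hL.le (sub_pos.1 (hx k)).le, fun k => ?_, fun n => ?_⟩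
    · set x := inv Z (2 * c * Cy / s k) - u₀ with hxdef
      have hxk : 0 < x := hx k
      obtain ⟨F, hFc, hFm, hFn⟩ := exists_net_rectangle hA hb (one_div_pos.2 hxk)
      classical
      refine ⟨F.subtype (· ∈ R), ?_, ?_, fun t => ?_⟩
      · obtain ⟨f, hf, -⟩ := hFn _ hq₀
        exact ⟨⟨f, hFm f hf⟩, Finset.mem_subtype.2 hf⟩
      · change _ ≤ Real.exp (entropy Z u₀ A (b' - b) (2 * c * Cy) (s k))
        rw [entropy, Real.exp_add, ← hxdef, Real.exp_log (by positivity),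
          Real.exp_log (by positivity)]
        have h1 : ((F.subtype (· ∈ R)).card : ℝ) ≤ F.card := by
          rw [Finset.card_subtype]
          exact_mod_cast Finset.card_filter_le _ _
        refine h1.trans (hFc.trans_eq ?_)
        field_simp
      · obtain ⟨f, hf, h1, h2⟩ := hFn t.1 t.2
        refine ⟨⟨f, hFm f hf⟩, Finset.mem_subtype.2 hf, ?_⟩
        have h := eLpNorm_sub_le_of_abs_le hZ hy hκ hCZ (one_div_pos.2 hxk) h1 h2
          (hU _ t.2) (hU f (hFm f hf))
        rw [one_div_one_div, hxdef, sub_add_cancel, apply_inv hZ.continuousOn hZ.strictMonoOn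
          hZ.tendsto_top ((hZ.strictMonoOn.monotoneOn self_mem_Ici hu hu).trans (hlt k).le)] at h
        have h3 := ENNReal.toReal_le_of_le_ofReal (by have := hs0 k; positivity) h
        calc Cy * (eLpNorm (fun ω => U t.1.2 t.1.1 ω - U f.2 f.1 ω) 2 P).toReal
            ≤ Cy * (2 / (2 * c * Cy / s k) * c) := by gcongr
          _ = s k := by field_simp
    · exact sum_mul_pow_le_integral hθ0 hθ1 hε
        (antitoneOn_Psi_entropy hφ hZ hA.le hL.le hK hKδ.le)
        (fun t ht => IsNFunction.Psi_nonneg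
          (entropy_nonneg hA.le hL.le (hZ.le_inv_div hK hKδ.le ht)))
        (intervalIntegrable_Psi_entropy hφ hZ hA.le hL.le hK (by positivity) hKδ.le) n

/-- The tail of the supremum of the field over one block. -/
lemma measure_block_le [IsProbabilityMeasure P] (hφ : IsNFunction φ) (hZ : IsAdmissible φ Z u₀)
    (hy : IsStrictlyPhiSubProcess P φ y Cy)
    (hκ : κ = Real.cos ∨ κ = Real.sin) (hCZ : CZsq P y Z u₀ N a ≠ ⊤) (hA : 0 < A)
    {U : ℝ → ℝ → Ω → ℝ} {b : ℕ → ℝ} {k : ℕ} (hb : b k < b (k + 1))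
    (hU : ∀ q ∈ Icc (-A) A ×ˢ Icc (b k) (b (k + 1)),
      HasMSIntegral P y (kernelI κ N a q.2 q.1) (U q.2 q.1))
    (hUc : ∀ᵐ ω ∂P, ContinuousOn (fun q : ℝ × ℝ => U q.2 q.1 ω)
      (Icc (-A) A ×ˢ Icc (b k) (b (k + 1))))
    (hθ0 : 0 < θ) (hθ1 : θ < 1) {w : ℝ} (hw0 : 0 < w)
    (hw : 2 * (entropyInt φ Z u₀ A (b (k + 1) - b k) (2 * CZ P y Z u₀ N a * Cy)
      (θ * blockEps P U Cy A b k) * (1 / (θ * (1 - θ)))) ≤ w / 2) :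
    P {ω | ∃ q ∈ Icc (-A) A ×ˢ Icc (b k) (b (k + 1)), w < |U q.2 q.1 ω|} ≤
      if blockEps P U Cy A b k = 0 then 0 else
        ENNReal.ofReal (2 * Real.exp (-conj φ ((1 - θ) * (w / 2) / blockEps P U Cy A b k))) := by
  have hθ' : 0 < 1 - θ := sub_pos.2 hθ1
  have hy2 : ∀ t, MemLp (y t) 2 P := fun t => (hy.mem _ (mem_range_self t)).memLp_two
  set R : Set (ℝ × ℝ) := Icc (-A) A ×ˢ Icc (b k) (b (k + 1)) with hR
  set ε := blockEps P U Cy A b k with hεdef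
  have hq₀ : ((-A, b k) : ℝ × ℝ) ∈ R := ⟨⟨le_rfl, by linarith⟩, ⟨le_rfl, hb.le⟩⟩
  have hbdd := bddAbove_sqrt_field hZ hy2 hκ hCZ hA hb hU
  have hnorm : ∀ q ∈ R, (eLpNorm (U q.2 q.1) 2 P).toReal =
      Real.sqrt (∫ ω, |U q.2 q.1 ω| ^ 2 ∂P) := by
    intro q hq
    rw [eLpNorm_two_eq_sqrt (hU q hq).1, ENNReal.toReal_ofReal (Real.sqrt_nonneg _)]
    simp [sq_abs]
  have hle : ∀ q ∈ R, Cy * (eLpNorm (U q.2 q.1) 2 P).toReal ≤ ε := by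
    intro q hq
    rw [hnorm q hq]
    exact mul_le_mul_of_nonneg_left (le_csSup hbdd (mem_image_of_mem _ hq)) hy.nonneg
  have hε0 : 0 ≤ ε := (mul_nonneg hy.nonneg ENNReal.toReal_nonneg).trans (hle _ hq₀)
  set X : R → Ω → ℝ := fun t => U t.1.2 t.1.1 with hX
  have hXm : ∀ t, MemLp (X t) 2 P := fun t => (hU t.1 t.2).1
  have hXs : ∀ t, SubExp P φ (X t) ε := fun t => ((hU t.1 t.2).subExp hφ hy).mono hφ
    (mul_nonneg hy.nonneg ENNReal.toReal_nonneg) (hle t.1 t.2)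
  have hXc : ∀ᵐ ω ∂P, Continuous fun t => X t ω := by
    filter_upwards [hUc] with ω hω using continuousOn_iff_continuous_domRestrict.1 hω
  have hset : {ω | ∃ q ∈ R, w < |U q.2 q.1 ω|} = {ω | ∃ t, w < |X t ω|} := by
    ext ω
    simp [hX]
  rw [hset]
  split_ifs with h0
  · rw [h0] at hXs
    exact (measure_exists_lt_abs_eq_zero hφ (fun t => (hXm t).aestronglyMeasurable.aemeasurable)
      hXs hXc hw0).le
  have hεpos : 0 < ε := lt_of_le_of_ne hε0 (Ne.symm h0)
  have hCy : 0 < Cy := by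
    refine lt_of_le_of_ne hy.nonneg fun h => h0 ?_
    rw [hεdef, blockEps, ← h, zero_mul]
  have hεZ : 0 < Z u₀ → ε ≤ Cy * (1 / (2 * Z u₀) * CZ P y Z u₀ N a) := by
    intro hZu
    refine mul_le_mul_of_nonneg_left (csSup_le ⟨_, mem_image_of_mem _ hq₀⟩ ?_) hCy.le
    rintro _ ⟨q, hq, rfl⟩
    change Real.sqrt (∫ ω, |U q.2 q.1 ω| ^ 2 ∂P) ≤ _
    rw [← hnorm q hq]
    exact ENNReal.toReal_le_of_le_ofReal (mul_nonneg (by positivity) (Real.sqrt_nonneg _))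
      (eLpNorm_field_le hZ hy2 hκ hCZ hZu (hU q hq))
  obtain ⟨H, hH, hnet, hB⟩ := exists_nets hφ hZ hy2 hκ hCZ hA hb hU hCy hεpos hθ0 hθ1 hεZ
  refine (measure_exists_lt_abs_le_of_nets hφ hXm hCy hθ0 hθ1 hεpos hXs
    (fun t t' => ((hU t.1 t.2).sub hy2 (hU t'.1 t'.2)).subExp hφ hy) hH hnet hB hXc
    (w := w) (by linarith)).trans (ENNReal.ofReal_le_ofReal ?_)
  have hmono : conj φ ((1 - θ) * (w / 2) / ε) ≤ conj φ ((1 - θ) * (w - 2 * (entropyInt φ Z u₀ A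
      (b (k + 1) - b k) (2 * CZ P y Z u₀ N a * Cy) (θ * ε) * (1 / (θ * (1 - θ))))) / ε) := by
    refine hφ.conj_mono (by positivity) ?_
    gcongr
    linarith
  gcongr

lemma blockMin_le {c : ℝ → ℝ} (hc : ContinuousOn c (Ici 0)) {b : ℕ → ℝ} {k : ℕ} (hb0 : 0 ≤ b k)
    {t : ℝ} (ht : t ∈ Icc (b k) (b (k + 1))) : blockMin c b k ≤ c t :=
  csInf_le (isCompact_Icc.image_of_continuousOn
    (hc.mono fun _ h => hb0.trans h.1)).bddBelow (mem_image_of_mem c ht)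

lemma blockMin_pos {c : ℝ → ℝ} (hc : ContinuousOn c (Ici 0)) (hcpos : ∀ t, 0 ≤ t → 0 < c t)
    {b : ℕ → ℝ} {k : ℕ} (hb0 : 0 ≤ b k) (hb : b k < b (k + 1)) : 0 < blockMin c b k := by
  obtain ⟨t, ht, h⟩ := (isCompact_Icc.image_of_continuousOn (f := c)
    (hc.mono fun _ h => hb0.trans h.1 : ContinuousOn c (Icc (b k) (b (k + 1))))).sInf_mem
    ((nonempty_Icc.2 hb.le).image c)
  rw [blockMin, ← h]
  exact hcpos t (hb0.trans ht.1)

lemma exists_mem_Icc_of_tendsto {b : ℕ → ℝ} (hb : Tendsto b atTop atTop) {t : ℝ} (ht : b 0 ≤ t) :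
    ∃ k, t ∈ Icc (b k) (b (k + 1)) := by
  by_contra! h
  have : ∀ k, b k ≤ t := by
    intro k
    induction k with
    | zero => exact ht
    | succ k ih => exact (lt_of_not_ge fun h' => h k ⟨ih, h'⟩).le
  obtain ⟨k, hk⟩ := (hb.eventually_gt_atTop t).exists
  exact absurd (this k) (not_le.2 hk)

end Blocks

end HeatSup

theorem mainTheorem2
    {Ω : Type*} [MeasurableSpace Ω] (P : Measure Ω) [IsProbabilityMeasure P]
    (φ : ℝ → ℝ) (hφ : HeatSup.IsNFunction φ) (hQ : HeatSup.ConditionQ φ)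
    (y : ℝ → Ω → ℝ) (Cy : ℝ) (hy : HeatSup.IsStrictlyPhiSubProcess P φ y Cy)
    (hvar : HeatSup.planeVariation (HeatSup.covFun P y) ≠ ⊤)
    (κ : ℝ → ℝ) (hκ : κ = Real.cos ∨ κ = Real.sin)
    (N : ℕ) (a : ℕ → ℝ) (A : ℝ) (hA : 0 < A)
    (U : ℝ → ℝ → Ω → ℝ)
    (hU : ∀ t, 0 ≤ t → ∀ x ∈ Icc (-A) A,
      HeatSup.HasMSIntegral P y (HeatSup.kernelI κ N a t x) (U t x))
    (hUcont : ∀ᵐ ω ∂P, ContinuousOn (fun q : ℝ × ℝ => U q.2 q.1 ω) (Icc (-A) A ×ˢ Ici 0))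
    (Z : ℝ → ℝ) (u₀ : ℝ) (hZ : HeatSup.IsAdmissible φ Z u₀)
    (hCZ : HeatSup.CZsq P y Z u₀ N a ≠ ⊤)
    (b : ℕ → ℝ) (hb0 : b 0 = 0) (hb : ∀ k, b k < b (k + 1))
    (hbA : ∀ k, 2 * A ≤ b (k + 1) - b k)
    (c : ℝ → ℝ) (hc : ContinuousOn c (Ici 0)) (hcpos : ∀ t, 0 ≤ t → 0 < c t)
    (hε : BddAbove (range fun k : ℕ =>
      HeatSup.blockEps P U Cy A b k / HeatSup.blockMin c b k))
    (θ : ℝ) (hθ0 : 0 < θ) (hθ1 : θ < 1)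
    (hI : BddAbove (range fun k : ℕ =>
      HeatSup.entropyInt φ Z u₀ A (b (k + 1) - b k) (2 * HeatSup.CZ P y Z u₀ N a * Cy)
        (θ * HeatSup.blockEps P U Cy A b k) / HeatSup.blockMin c b k))
    (u s : ℝ)
    (hs : (⨆ k : ℕ, 4 * HeatSup.blockEps P U Cy A b k /
      (HeatSup.blockMin c b k * (1 - θ))) < s)
    (hsu : s < u / 2)
    (hsum : Summable fun k : ℕ => HeatSup.blockTerm φ θ s (HeatSup.blockMin c b k)
      (HeatSup.blockEps P U Cy A b k))
    (hu : (⨆ k : ℕ, HeatSup.entropyInt φ Z u₀ A (b (k + 1) - b k)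
        (2 * HeatSup.CZ P y Z u₀ N a * Cy) (θ * HeatSup.blockEps P U Cy A b k) /
        HeatSup.blockMin c b k * (4 / (θ * (1 - θ)))) < u) :
    P {ω | ENNReal.ofReal u <
        ⨆ q ∈ Icc (-A) A ×ˢ Ici (0 : ℝ), ENNReal.ofReal (|U q.2 q.1 ω| / c q.2)} ≤
      ENNReal.ofReal (2 * Real.exp (-HeatSup.conj φ (u / s)) *
        ∑' k : ℕ, HeatSup.blockTerm φ θ s (HeatSup.blockMin c b k)
          (HeatSup.blockEps P U Cy A b k)) := by
  have hθ' : 0 < 1 - θ := sub_pos.2 hθ1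
  have hbnn : ∀ k, 0 ≤ b k := fun k => hb0 ▸ (strictMono_nat_of_lt_succ hb).monotone (Nat.zero_le k)
  have hbtop : Tendsto b atTop atTop := by
    have hlin : ∀ k : ℕ, k * (2 * A) ≤ b k := by
      intro k
      induction k with
      | zero => simp [hb0]
      | succ k ih =>
        push_cast
        linarith [hbA k]
    exact tendsto_atTop_mono hlin (tendsto_natCast_atTop_atTop.atTop_mul_const (by linarith))
  set m := HeatSup.blockMin c b with hm
  set e := HeatSup.blockEps P U Cy A b with he
  set I : ℕ → ℝ := fun k => HeatSup.entropyInt φ Z u₀ A (b (k + 1) - b k)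
    (2 * HeatSup.CZ P y Z u₀ N a * Cy) (θ * e k) with hIdef
  have hmpos : ∀ k, 0 < m k := fun k => HeatSup.blockMin_pos hc hcpos (hbnn k) (hb k)
  have he0 : ∀ k, 0 ≤ e k := fun k => mul_nonneg hy.nonneg (Real.sSup_nonneg (by
    rintro _ ⟨q, -, rfl⟩
    exact Real.sqrt_nonneg _))
  have hsk : ∀ k, 4 * e k / (m k * (1 - θ)) < s := by
    refine fun k => lt_of_le_of_lt (le_ciSup (f := fun k => 4 * e k / (m k * (1 - θ))) ?_ k) hs
    obtain ⟨M, hM⟩ := hε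
    refine ⟨M * (4 / (1 - θ)), ?_⟩
    rintro _ ⟨k, rfl⟩
    calc 4 * e k / (m k * (1 - θ)) = e k / m k * (4 / (1 - θ)) := by
          have := (hmpos k).ne'
          field_simp
      _ ≤ _ := by
          gcongr
          exact hM (mem_range_self k)
  have hs0 : 0 < s := lt_of_le_of_lt (div_nonneg (mul_nonneg zero_le_four (he0 0))
    (mul_nonneg (hmpos 0).le hθ'.le)) (hsk 0)
  have hu0 : 0 < u := by linarith
  have huk : ∀ k, I k / m k * (4 / (θ * (1 - θ))) < u := by
    refine fun k => lt_of_le_of_lt (le_ciSup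
      (f := fun k => I k / m k * (4 / (θ * (1 - θ)))) ?_ k) hu
    obtain ⟨M, hM⟩ := hI
    refine ⟨M * (4 / (θ * (1 - θ))), ?_⟩
    rintro _ ⟨k, rfl⟩
    have hMk : I k / m k ≤ M := hM (mem_range_self k)
    change I k / m k * (4 / (θ * (1 - θ))) ≤ _
    gcongr
  have hblock : ∀ k, P {ω | ∃ q ∈ Icc (-A) A ×ˢ Icc (b k) (b (k + 1)), u * m k < |U q.2 q.1 ω|} ≤
      ENNReal.ofReal (2 * Real.exp (-HeatSup.conj φ (u / s)) *
        HeatSup.blockTerm φ θ s (m k) (e k)) := by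
    intro k
    have hmk := hmpos k
    have hw := huk k
    rw [div_mul_eq_mul_div, div_lt_iff₀ hmk] at hw
    refine (HeatSup.measure_block_le hφ hZ hy hκ hCZ hA (hb k)
      (fun q hq => hU q.2 ((hbnn k).trans hq.2.1) q.1 hq.1)
      (hUcont.mono fun ω hω => hω.mono (prod_mono_right fun t ht => (hbnn k).trans ht.1))
      hθ0 hθ1 (mul_pos hu0 hmk) ?_).trans ?_
    · change 2 * (I k * (1 / (θ * (1 - θ)))) ≤ u * m k / 2
      have : I k * (4 / (θ * (1 - θ))) = 4 * (I k * (1 / (θ * (1 - θ)))) := by ring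
      linarith
    · change (if e k = 0 then 0 else _) ≤ _
      unfold HeatSup.blockTerm
      split_ifs with h0
      · exact zero_le
      · have hek : 0 < e k := lt_of_le_of_ne (he0 k) (Ne.symm h0)
        refine ENNReal.ofReal_le_ofReal ?_
        rw [mul_assoc, ← Real.exp_add]
        have h2 : 2 ≤ s * m k * (1 - θ) / (2 * e k) := by
          have h := (hsk k).le
          rw [div_le_iff₀ (by positivity)] at h
          rw [le_div_iff₀ (by positivity)]
          linarith
        have hconj := hφ.conj_add_le_conj_mul
          (by rw [le_div_iff₀ hs0]; linarith : 2 ≤ u / s) h2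
        rw [show u / s * (s * m k * (1 - θ) / (2 * e k)) = (1 - θ) * (u * m k / 2) / e k by
          field_simp] at hconj
        gcongr
        linarith
  calc P {ω | ENNReal.ofReal u <
        ⨆ q ∈ Icc (-A) A ×ˢ Ici (0 : ℝ), ENNReal.ofReal (|U q.2 q.1 ω| / c q.2)}
      ≤ P (⋃ k, {ω | ∃ q ∈ Icc (-A) A ×ˢ Icc (b k) (b (k + 1)), u * m k < |U q.2 q.1 ω|}) := by
        refine measure_mono fun ω hω => ?_
        simp only [mem_ofPred_eq, lt_iSup_iff] at hω
        obtain ⟨q, hq, hlt⟩ := hω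
        obtain ⟨k, hk⟩ := HeatSup.exists_mem_Icc_of_tendsto hbtop (hb0 ▸ hq.2 : b 0 ≤ q.2)
        refine mem_iUnion.2 ⟨k, q, ⟨hq.1, hk⟩, ?_⟩
        have h1 := (ENNReal.ofReal_lt_ofReal_iff_of_nonneg hu0.le).1 hlt
        rw [lt_div_iff₀ (hcpos q.2 hq.2)] at h1
        exact lt_of_le_of_lt
          (mul_le_mul_of_nonneg_left (HeatSup.blockMin_le hc (hbnn k) hk) hu0.le) h1
    _ ≤ ∑' k, P {ω | ∃ q ∈ Icc (-A) A ×ˢ Icc (b k) (b (k + 1)), u * m k < |U q.2 q.1 ω|} :=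
        measure_iUnion_le _
    _ ≤ ∑' k, ENNReal.ofReal (2 * Real.exp (-HeatSup.conj φ (u / s)) *
          HeatSup.blockTerm φ θ s (m k) (e k)) := ENNReal.tsum_le_tsum hblock
    _ = _ := by
        rw [← tsum_mul_left, ENNReal.ofReal_tsum_of_nonneg _ (hsum.mul_left _)]
        intro k
        unfold HeatSup.blockTerm
        split_ifs <;> positivity
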